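/- Let $k$ be a field and let $A=\bigoplus_{n\ge 0}A_n$ be a graded (not necessarily commutative) $k$-algebra with $A_0=k$, with all $A_n$ finite-dimensional, and generated by $V=A_1$ as a $k$-algebra. Put $\mathfrak m=\bigoplus_{n>0}A_n$. Assume that $A$ is Koszul, i.e. the left $A$-module $k=A/\mathfrak m$ has a graded free resolution $P_\bullet$ with $P_i$ generated in degree $i$. Let $A^!=T(V^*)/(Q_2^\perp)$ be the quadratic dual of $A$, where $Q_2=\ker(V\otimes_k V\to A)$ and $Q_2^\perp\subseteq V^*\otimes_k V^*$ is its orthogonal complement for the pairing $\langle v_1\otimes v_2,f_1\otimes f_2\rangle=f_1(v_1)f_2(v_2)$. Let $(A^!)^*_i$ be the $k$-dual of the span of the products of $i$ elements of $V^*$ in $A^!$, with the actions $(c\cdot f)(y)=c(fy)$ and $(f\cdot c)(y)=c(yf)$ of $f\in V^*$. Let $x_1,\dots,x_d$ be a basis of $V$ with dual basis $x_1^*,\dots,x_d^*$, and for $i,j\ge 0$ put $F_{ij}=A\otimes_k(A^!)^*_i\otimes_k A_j$, a left $A$-module through the first factor, with the maps $$\partial':F_{ij}\to F_{i-1,j},\quad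 y\otimes c\otimes b\mapsto\sum_l yx_l\otimes (c\cdot x_l^*)\otimes b,$$ $$(-1)^i\partial'':F_{ij}\to F_{i-1,j+1},\quad y\otimes c\otimes b\mapsto(-1)^i\sum_l y\otimes (x_l^*\cdot c)\otimes x_lb .$$ Let $a\ge 1$. Let $\mathbb X^A_a=A\otimes_k(A^!)^*\otimes_k A_{\le a-1}$ be the totalization of the double complex $(F_{ij})$ with the columns $j\ge a$ removed; that is, $(\mathbb X^A_a)_n=\bigoplus_{j=0}^{a-1}F_{nj}$ with differential $\partial'+(-1)^n\partial''$, where the component of $\partial''$ into the column $j=a$ is omitted, graded so that $A_p\otimes_k (A^!)^*_n\otimes_k A_j$ has internal degree $p+n+j$. Then $\mathbb X^A_a$, with the augmentation $(\mathbb X^A_a)_0\to A/\mathfrak m^a$ induced by $y\otimes c\otimes b\mapsto c(1)\,yb$, is a graded free resolution of the left $A$-module $A/\mathfrak m^a$: every $(\mathbb X^A_a)_n$ is a graded free left $A$-module, all the maps are $A$-linear and homogeneous of degree $0$, and $$\cdots\to(\mathbb X^A_a)_1\to(\mathbb X^A_a)_0\to A/\mathfrak m^a\to 0$$ is exact. Moreover,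 let $\mathbb F^A$ be the complex with terms $F_n=A\otimes_k(A^!)^*_n\otimes_k A$ and differential $\partial'+(-1)^n\partial''$ given by the same formulas, augmented to $A$ by $y\otimes c\otimes b\mapsto c(1)\,yb$. Then the maps $y\otimes c\otimes b\mapsto y\otimes c\otimes b$ (for $b\in A_j$, $j<a$) give an isomorphism of augmented complexes of left $A$-modules $\mathbb F^A\otimes_A A/\mathfrak m^a\cong\mathbb X^A_a$, where $F_n\otimes_A A/\mathfrak m^a=F_n/F_n\mathfrak m^a$. -/

import Mathlib

open scoped TensorProduct DirectSum

noncomputable section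

namespace KoszulTrunc

universe u v w w'

section GradedModules

variable {k : Type u} {A : Type v} [Field k] [Ring A] [Algebra k A]

/-- The standing assumptions on a graded `k`-algebra `A = ⨁ A_n` (indexed by `ℕ`):
`A_0 = k`, every graded component is finite-dimensional over `k`, and `A` is generated
by `A_1` as a `k`-algebra. -/
structure IsStandardGraded (𝒜 : ℕ → Submodule k A) : Prop where
  algebraMap_injective : Function.Injective (algebraMap k A)
  zero_eq : (𝒜 0 : Set A) = Set.range (algebraMap k A)
  finite : ∀ n, FiniteDimensional k (𝒜 n)
  adjoin_eq_top : Algebra.adjoin k (𝒜 1 : Set A) = ⊤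

/-- `M = ⨁ M_n` is a graded left `A`-module which is graded free: it has an `A`-basis
consisting of homogeneous elements. -/
structure IsGradedFree (𝒜 : ℕ → Submodule k A) {M : Type w} [AddCommGroup M] [Module k M]
    [Module A M] [IsScalarTower k A M] (ℳ : ℕ → Submodule k M) : Prop where
  isInternal : DirectSum.IsInternal ℳ
  smul_mem : ∀ (i j : ℕ) (y : A) (m : M), y ∈ 𝒜 i → m ∈ ℳ j → y • m ∈ ℳ (i + j)
  exists_basis : ∃ (S : Type w) (b : Module.Basis S A M), ∀ s, ∃ n, b s ∈ ℳ n

/-- `⋯ → P_2 → P_1 → P_0 → M → 0` is a graded free resolution of the graded left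
`A`-module `M`: each `P_n` is graded free, all maps are `A`-linear and homogeneous of
degree `0`, and the sequence is exact. -/
structure IsGradedFreeResolution (𝒜 : ℕ → Submodule k A)
    {P : ℕ → Type w} [∀ n, AddCommGroup (P n)] [∀ n, Module k (P n)] [∀ n, Module A (P n)]
    [∀ n, IsScalarTower k A (P n)] (grP : ∀ n, ℕ → Submodule k (P n))
    (d : ∀ n, P (n + 1) →ₗ[A] P n)
    {M : Type w'} [AddCommGroup M] [Module k M] [Module A M]
    (ℳ : ℕ → Submodule k M) (ε : P 0 →ₗ[A] M) : Prop where
  gradedFree : ∀ n, IsGradedFree 𝒜 (grP n)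
  d_mem : ∀ n N x, x ∈ grP (n + 1) N → d n x ∈ grP n N
  ε_mem : ∀ N x, x ∈ grP 0 N → ε x ∈ ℳ N
  exact_d : ∀ n, Function.Exact (d (n + 1)) (d n)
  exact_ε : Function.Exact (d 0) ε
  surjective_ε : Function.Surjective ε

/-- The grading on a quotient `A ⧸ I` of `A` by a left ideal induced by that of `A`. -/
def quotGrading (𝒜 : ℕ → Submodule k A) (I : Ideal A) (n : ℕ) : Submodule k (A ⧸ I) :=
  (𝒜 n).map (I.mkQ.restrictScalars k)

/-- The homogeneous maximal ideal `𝔪 = A_{>0}`. -/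
abbrev maxIdeal (𝒜 : ℕ → Submodule k A) [GradedAlgebra 𝒜] : Ideal A :=
  (HomogeneousIdeal.irrelevant 𝒜).toIdeal

/-- `A` is Koszul: the residue field `k = A ⧸ A_{>0}` has a linear graded free resolution
over `A`, i.e. a graded free resolution `P` with `P_i` generated in degree `i`. -/
def IsKoszul (𝒜 : ℕ → Submodule k A) [GradedAlgebra 𝒜] : Prop :=
  ∃ (P : ℕ → Type v) (_ : ∀ n, AddCommGroup (P n)) (_ : ∀ n, Module k (P n))
    (_ : ∀ n, Module A (P n)) (_ : ∀ n, IsScalarTower k A (P n))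
    (grP : ∀ n, ℕ → Submodule k (P n)) (d : ∀ n, P (n + 1) →ₗ[A] P n)
    (ε : P 0 →ₗ[A] A ⧸ maxIdeal 𝒜),
    IsGradedFreeResolution 𝒜 grP d (quotGrading 𝒜 (maxIdeal 𝒜)) ε ∧
      ∀ i, Submodule.span A (grP i i : Set (P i)) = ⊤

end GradedModules

section QuadraticDual

variable {k : Type u} {A : Type v} [Field k] [Ring A] [Algebra k A]
  (𝒜 : ℕ → Submodule k A)

/-- The space of quadratic relations `Q_2 ⊆ V ⊗ V` of `A`, where `V = A_1`: the kernel of the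
multiplication `V ⊗ V → A`, i.e. the degree `2` part of the kernel of `T(V) → A`. -/
def quadRel : Submodule k (𝒜 1 ⊗[k] 𝒜 1) :=
  LinearMap.ker (LinearMap.mul' k A ∘ₗ TensorProduct.map (𝒜 1).subtype (𝒜 1).subtype)

/-- The orthogonal complement of `Q_2` in `V* ⊗ V*` with respect to the pairing
`⟨v₁ ⊗ v₂, f₁ ⊗ f₂⟩ = f₁(v₁) f₂(v₂)`. -/
def quadRelPerp : Submodule k (Module.Dual k (𝒜 1) ⊗[k] Module.Dual k (𝒜 1)) where
  carrier := {t | ∀ q ∈ quadRel 𝒜, TensorProduct.dualDistrib k (𝒜 1) (𝒜 1) t q = 0}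
  add_mem' := by
    intro s t hs ht q hq
    simp [hs q hq, ht q hq]
  zero_mem' := by
    intro q _
    simp
  smul_mem' := by
    intro c t ht q hq
    simp [ht q hq]

/-- The relations of the quadratic dual: the image of the orthogonal complement of `Q_2` in
the tensor algebra `T(V*)` is set to zero. -/
def dualRel (s t : TensorAlgebra k (Module.Dual k (𝒜 1))) : Prop :=
  (∃ q ∈ quadRelPerp 𝒜, s = LinearMap.mul' k (TensorAlgebra k (Module.Dual k (𝒜 1)))
    (TensorProduct.map (TensorAlgebra.ι k) (TensorAlgebra.ι k) q)) ∧ t = 0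

/-- The quadratic dual algebra `A^! = T(V*) / Q^⊥`. -/
abbrev QuadraticDual : Type _ := RingQuot (dualRel 𝒜)

/-- The canonical map `V* → A^!`. -/
def dualGen : Module.Dual k (𝒜 1) →ₗ[k] QuadraticDual 𝒜 :=
  (RingQuot.mkAlgHom k (dualRel 𝒜)).toLinearMap ∘ₗ TensorAlgebra.ι k

/-- The component of `A^!` spanned by the products of `n` elements of `V*`. It has degree
`-n` if the elements of `V*` are given degree `-1`. -/
def dualComponent (n : ℕ) : Submodule k (QuadraticDual 𝒜) :=
  (LinearMap.range (dualGen 𝒜)) ^ n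

/-- `(A^!)^*_n`, the `k`-dual of the `n`-th component of `A^!`. -/
abbrev CoDual (n : ℕ) : Type _ := Module.Dual k (dualComponent 𝒜 n)

/-- The map `(A^!)_n → (A^!)_{n+1}`, `y ↦ f y`, for `f ∈ V*`. -/
def genMulLeft (n : ℕ) (f : Module.Dual k (𝒜 1)) :
    dualComponent 𝒜 n →ₗ[k] dualComponent 𝒜 (n + 1) :=
  (LinearMap.mulLeft k (dualGen 𝒜 f)).restrict (by
    intro y hy
    rw [dualComponent, pow_succ']
    exact Submodule.mul_mem_mul ⟨f, rfl⟩ hy)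

/-- The map `(A^!)_n → (A^!)_{n+1}`, `y ↦ y f`, for `f ∈ V*`. -/
def genMulRight (n : ℕ) (f : Module.Dual k (𝒜 1)) :
    dualComponent 𝒜 n →ₗ[k] dualComponent 𝒜 (n + 1) :=
  (LinearMap.mulRight k (dualGen 𝒜 f)).restrict (by
    intro y hy
    rw [dualComponent, pow_succ]
    exact Submodule.mul_mem_mul hy ⟨f, rfl⟩)

/-- The right action of `f ∈ V*` on `(A^!)^*`: `(c · f)(y) = c (f y)`. -/
def codualRight (n : ℕ) (f : Module.Dual k (𝒜 1)) : CoDual 𝒜 (n + 1) →ₗ[k] CoDual 𝒜 n :=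
  (genMulLeft 𝒜 n f).dualMap

/-- The left action of `f ∈ V*` on `(A^!)^*`: `(f · c)(y) = c (y f)`. -/
def codualLeft (n : ℕ) (f : Module.Dual k (𝒜 1)) : CoDual 𝒜 (n + 1) →ₗ[k] CoDual 𝒜 n :=
  (genMulRight 𝒜 n f).dualMap

end QuadraticDual

section Terms

variable {k : Type u} {A : Type v} [Field k] [Ring A] [Algebra k A]
  (𝒜 : ℕ → Submodule k A)

/-- `A ⊗ (A^!)^*_n ⊗ W`, a left `A`-module through the first factor. -/
abbrev Term (n : ℕ) (W : Type w) [AddCommGroup W] [Module k W] : Type _ :=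
  A ⊗[k] (CoDual 𝒜 n ⊗[k] W)

variable {ι : Type*} [Fintype ι] (x : Module.Basis ι k (𝒜 1))

/-- `∂'`, right multiplication by `∑ x_l ⊗ x_l^* ⊗ 1`:
`y ⊗ c ⊗ b ↦ ∑ y x_l ⊗ (c · x_l^*) ⊗ b`. -/
def dVert (n : ℕ) (W : Type w) [AddCommGroup W] [Module k W] :
    Term 𝒜 (n + 1) W →ₗ[A] Term 𝒜 n W :=
  ∑ l, TensorProduct.AlgebraTensorModule.map (LinearMap.toSpanSingleton A A (x l : A))
    (TensorProduct.map (codualRight 𝒜 n (x.coord l)) LinearMap.id)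

/-- `∂''`, left multiplication by `∑ 1 ⊗ x_l^* ⊗ x_l`:
`y ⊗ c ⊗ b ↦ ∑ y ⊗ (x_l^* · c) ⊗ x_l b`, where `μ v : W → W'` is the multiplication
`b ↦ v b` by `v ∈ V`. -/
def dHor (n : ℕ) {W : Type w} [AddCommGroup W] [Module k W] {W' : Type w'} [AddCommGroup W']
    [Module k W'] (μ : 𝒜 1 → W →ₗ[k] W') : Term 𝒜 (n + 1) W →ₗ[A] Term 𝒜 n W' :=
  ∑ l, TensorProduct.AlgebraTensorModule.map LinearMap.id
    (TensorProduct.map (codualLeft 𝒜 n (x.coord l)) (μ (x l)))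

/-- The multiplication `A → (A → A)`, as a left `A`-linear map. -/
def mulAct (k : Type u) (A : Type v) [Field k] [Ring A] [Algebra k A] : A →ₗ[A] A →ₗ[k] A where
  toFun := LinearMap.mulLeft k
  map_add' := by
    intro y z
    ext b
    simp [add_mul]
  map_smul' := by
    intro y z
    ext b
    simp

/-- The unit `1` of `A^!` as an element of the component `(A^!)_0 = k`. -/
def dualOne : dualComponent 𝒜 0 :=
  ⟨1, by rw [dualComponent, pow_zero]; exact Submodule.one_le.mp le_rfl⟩

/-- The map `A ⊗ (A^!)^*_0 ⊗ W → A`, `y ⊗ c ⊗ b ↦ c(1) y e(b)`, for a map `e : W → A`. As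
`(A^!)^*_0 = k`, this is multiplication across the tensor when `e` is an inclusion. -/
def multMap {W : Type w} [AddCommGroup W] [Module k W] (e : W →ₗ[k] A) : Term 𝒜 0 W →ₗ[A] A :=
  TensorProduct.AlgebraTensorModule.lift (mulAct k A) ∘ₗ
    TensorProduct.AlgebraTensorModule.map LinearMap.id
      (TensorProduct.lift
        ((LinearMap.lsmul k (W →ₗ[k] A)).flip e ∘ₗ
          Module.Dual.eval k (dualComponent 𝒜 0) (dualOne 𝒜)))

end Terms

section Bimodule

variable {k : Type u} {A : Type v} [Field k] [Ring A] [Algebra k A]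
  (𝒜 : ℕ → Submodule k A) {ι : Type*} [Fintype ι] (x : Module.Basis ι k (𝒜 1))

/-- `F_n = A ⊗ (A^!)^*_n ⊗ A`. -/
abbrev FTerm (n : ℕ) : Type _ := Term 𝒜 n A

/-- The differential `∂_{n+1} = ∂' + (-1)^{n+1} ∂'' : F_{n+1} → F_n`. -/
def FDiff (n : ℕ) : FTerm 𝒜 (n + 1) →ₗ[A] FTerm 𝒜 n :=
  dVert 𝒜 x n A + (-1 : ℤ) ^ (n + 1) • dHor 𝒜 x n (fun v => LinearMap.mulLeft k (v : A))

/-- The augmentation `F_0 → A`, multiplication across the tensor. -/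
def FAug : FTerm 𝒜 0 →ₗ[A] A := multMap 𝒜 LinearMap.id

/-- The right action of `b ∈ A` on `F_n`. -/
def FMulRight (n : ℕ) (b : A) : FTerm 𝒜 n →ₗ[A] FTerm 𝒜 n :=
  TensorProduct.AlgebraTensorModule.map LinearMap.id
    (TensorProduct.map LinearMap.id (LinearMap.mulRight k b))

/-- The submodule `F_n I` for a left ideal `I`, so that `F_n ⧸ F_n I = F_n ⊗_A (A ⧸ I)`. -/
def FMulIdeal (n : ℕ) (I : Ideal A) : Submodule A (FTerm 𝒜 n) :=
  Submodule.span A {z | ∃ w : FTerm 𝒜 n, ∃ b ∈ I, z = FMulRight 𝒜 n b w}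

end Bimodule

section Truncation

variable {k : Type u} {A : Type v} [Field k] [Ring A] [Algebra k A]
  (𝒜 : ℕ → Submodule k A)

/-- The multiplication `A_j → A_{j+1}`, `b ↦ v b`, by `v ∈ V = A_1`. -/
def mulComponent [GradedAlgebra 𝒜] (j : ℕ) (v : 𝒜 1) : 𝒜 j →ₗ[k] 𝒜 (j + 1) :=
  (LinearMap.mulLeft k (v : A)).restrict (by
    intro b hb
    rw [add_comm j 1]
    exact SetLike.GradedMul.mul_mem v.2 hb)

/-- The term `F_{ij} = A ⊗ (A^!)^*_i ⊗ A_j` of the double complex. Its total (homological)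
degree is `i`. -/
abbrev BiTerm (i j : ℕ) : Type _ := Term 𝒜 i (𝒜 j)

/-- The term of degree `n` of the totalization of the double complex truncated to the columns
`j < a`: `(X_a)_n = ⨁_{j < a} F_{nj} = A ⊗ (A^!)^*_n ⊗ A_{≤ a-1}`. -/
abbrev XTerm (a n : ℕ) : Type _ := ⨁ j : Fin a, BiTerm 𝒜 n j

/-- The internal grading of `(X_a)_n`: the element `y ⊗ c ⊗ b` of `A_p ⊗ (A^!)^*_n ⊗ A_j` has
degree `p + n + j`. -/
def XGrading (a n N : ℕ) : Submodule k (XTerm 𝒜 a n) :=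
  Submodule.span k {z | ∃ (j : Fin a) (p : ℕ) (y : 𝒜 p) (c : CoDual 𝒜 n) (b : 𝒜 j),
    p + n + j = N ∧
      z = DirectSum.lof A (Fin a) (fun j => BiTerm 𝒜 n j) j ((y : A) ⊗ₜ[k] (c ⊗ₜ[k] b))}

variable [GradedAlgebra 𝒜] {ι : Type*} [Fintype ι] (x : Module.Basis ι k (𝒜 1))

/-- The differential of the totalization. On the summand `F_{n+1,j}` it is the sum of the
vertical map `∂' : F_{n+1,j} → F_{n,j}` and of the horizontal map
`(-1)^{n+1} ∂'' : F_{n+1,j} → F_{n,j+1}`, the latter being omitted if the column `j + 1` has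
been removed. -/
def XDiff (a n : ℕ) : XTerm 𝒜 a (n + 1) →ₗ[A] XTerm 𝒜 a n :=
  DirectSum.toModule A (Fin a) (XTerm 𝒜 a n) fun j =>
    DirectSum.lof A (Fin a) (fun j => BiTerm 𝒜 n j) j ∘ₗ dVert 𝒜 x n (𝒜 j) +
      if h : (j : ℕ) + 1 < a then
        (-1 : ℤ) ^ (n + 1) •
          (DirectSum.lof A (Fin a) (fun j => BiTerm 𝒜 n j) ⟨j + 1, h⟩ ∘ₗ
            dHor 𝒜 x n (mulComponent 𝒜 j))
      else 0

/-- The augmentation `(X_a)_0 → A ⧸ 𝔪^a` induced by multiplication across the tensor. -/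
def XAug (a : ℕ) : XTerm 𝒜 a 0 →ₗ[A] A ⧸ maxIdeal 𝒜 ^ a :=
  DirectSum.toModule A (Fin a) (A ⧸ maxIdeal 𝒜 ^ a) fun j =>
    (maxIdeal 𝒜 ^ a).mkQ ∘ₗ multMap 𝒜 (𝒜 j).subtype

end Truncation

end KoszulTrunc

end

/-! Filter $\mathbb X^A_a$ by the columns $j\ge m$. The differential is triangular: $\partial'$
preserves the column and $\partial''$ raises it by one. So exactness follows from exactness of the
single columns, clearing one leading term after another (`mem_range_of_triangular`). Column $j$ is
the Koszul complex $A\otimes(A^!)^*_\bullet$ tensored over $k$ with $A_j$; it is exact, with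
cokernel $A_j$, because $A$ is Koszul. The pieces $A_j$, $j<a$, make up $A/\mathfrak m^a$ because
$\mathfrak m^a=A_{\ge a}$.

Koszulness is given as the existence of some linear resolution $P$, so exactness of the Koszul
complex has to be derived (`koszulDiff_exact`, `koszulAug_exact`). Linearity gives $P_n\cong
A\otimes(P_n)_n$, and $d$ identifies $(P_{n+2})_{n+2}$ with the kernel of
$V\otimes(P_{n+1})_{n+1}\to A_2\otimes(P_n)_n$. The spaces $(A^!)^*_n$ obey the same recursion
(`exists_codualRight_coord_eq`), so the two complexes are isomorphic. The substantial half of that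
recursion is that each element of the kernel comes from a functional on $A^!$; the functional is
read off from an extension of the right $A^!$-module $\prod_m(A^!)^*_m$ by one new generator
(`exists_codualRight_eq`).

That $\mathbb X^A_a$ is a complex is inherited from $\mathbb F^A$, where
$\partial'^2=\partial''^2=0$ by $Q_2^{\perp\perp}=Q_2$ and the two differentials commute. The
truncation `truncMap` is a surjective chain map $\mathbb F^A\to\mathbb X^A_a$ with kernel
$F_n\mathfrak m^a$ in degree $n$, which also gives the isomorphism of complexes. -/

noncomputable section

namespace KoszulTrunc

/-! ### Quadratic duality: the relations of $A$ against those of $A^!$ -/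

section QuadraticDuality

variable {k : Type*} {A : Type*} [Field k] [Ring A] [Algebra k A] (𝒜 : ℕ → Submodule k A)

@[simp] theorem codualRight_apply (n : ℕ) (f : Module.Dual k (𝒜 1)) (c : CoDual 𝒜 (n + 1))
    (y : dualComponent 𝒜 n) : codualRight 𝒜 n f c y = c (genMulLeft 𝒜 n f y) := rfl

@[simp] theorem codualLeft_apply (n : ℕ) (f : Module.Dual k (𝒜 1)) (c : CoDual 𝒜 (n + 1))
    (y : dualComponent 𝒜 n) : codualLeft 𝒜 n f c y = c (genMulRight 𝒜 n f y) := rfl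

@[simp] theorem coe_genMulLeft (n : ℕ) (f : Module.Dual k (𝒜 1)) (y : dualComponent 𝒜 n) :
    (genMulLeft 𝒜 n f y : QuadraticDual 𝒜) = dualGen 𝒜 f * y := rfl

@[simp] theorem coe_genMulRight (n : ℕ) (f : Module.Dual k (𝒜 1)) (y : dualComponent 𝒜 n) :
    (genMulRight 𝒜 n f y : QuadraticDual 𝒜) = y * dualGen 𝒜 f := rfl

/-- The relations of the quadratic dual hold in it. -/
theorem mul'_map_dualGen_eq_zero {q : Module.Dual k (𝒜 1) ⊗[k] Module.Dual k (𝒜 1)}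
    (hq : q ∈ quadRelPerp 𝒜) :
    LinearMap.mul' k _ (TensorProduct.map (dualGen 𝒜) (dualGen 𝒜) q) = 0 := by
  have h := RingQuot.mkAlgHom_rel k (s := dualRel 𝒜) ⟨⟨q, hq, rfl⟩, rfl⟩
  rw [map_zero] at h
  rw [← h]
  clear h hq
  induction q with
  | zero => simp
  | add a b ha hb => simp only [map_add, ha, hb]
  | tmul a b => simp [dualGen]

/-- The right action of `V*` on `(A^!)^*` as a bilinear map. -/
def codualRightHom (n : ℕ) : Module.Dual k (𝒜 1) →ₗ[k] CoDual 𝒜 (n + 1) →ₗ[k] CoDual 𝒜 n :=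
  LinearMap.mk₂ k (fun f c => codualRight 𝒜 n f c)
    (by
      intro f g c
      ext y
      have : genMulLeft 𝒜 n (f + g) y = genMulLeft 𝒜 n f y + genMulLeft 𝒜 n g y := by
        ext; simp [add_mul]
      simp [this])
    (by
      intro r f c
      ext y
      have : genMulLeft 𝒜 n (r • f) y = r • genMulLeft 𝒜 n f y := by
        ext; simp
      simp [this])
    (by intro f c d; simp) (by intro r f c; simp)

@[simp] theorem codualRightHom_apply (n : ℕ) (f : Module.Dual k (𝒜 1)) (c : CoDual 𝒜 (n + 1)) :
    codualRightHom 𝒜 n f c = codualRight 𝒜 n f c := rfl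

/-- The left action of `V*` on `(A^!)^*` as a bilinear map. -/
def codualLeftHom (n : ℕ) : Module.Dual k (𝒜 1) →ₗ[k] CoDual 𝒜 (n + 1) →ₗ[k] CoDual 𝒜 n :=
  LinearMap.mk₂ k (fun f c => codualLeft 𝒜 n f c)
    (by
      intro f g c
      ext y
      have : genMulRight 𝒜 n (f + g) y = genMulRight 𝒜 n f y + genMulRight 𝒜 n g y := by
        ext; simp [mul_add]
      simp [this])
    (by
      intro r f c
      ext y
      have : genMulRight 𝒜 n (r • f) y = r • genMulRight 𝒜 n f y := by
        ext; simp
      simp [this])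
    (by intro f c d; simp) (by intro r f c; simp)

@[simp] theorem codualLeftHom_apply (n : ℕ) (f : Module.Dual k (𝒜 1)) (c : CoDual 𝒜 (n + 1)) :
    codualLeftHom 𝒜 n f c = codualLeft 𝒜 n f c := rfl

/-- For `c ∈ (A^!)^*`, the map `f ⊗ g ↦ (c · f) · g`. -/
def codualRight₂ (n : ℕ) (c : CoDual 𝒜 (n + 2)) :
    Module.Dual k (𝒜 1) ⊗[k] Module.Dual k (𝒜 1) →ₗ[k] CoDual 𝒜 n :=
  TensorProduct.lift ((codualRightHom 𝒜 n).flip ∘ₗ (codualRightHom 𝒜 (n + 1)).flip c)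

@[simp] theorem codualRight₂_tmul (n : ℕ) (c : CoDual 𝒜 (n + 2)) (f g : Module.Dual k (𝒜 1)) :
    codualRight₂ 𝒜 n c (f ⊗ₜ g) = codualRight 𝒜 n g (codualRight 𝒜 (n + 1) f c) := by
  simp [codualRight₂]

/-- For `c ∈ (A^!)^*`, the map `f ⊗ g ↦ f · (g · c)`. -/
def codualLeft₂ (n : ℕ) (c : CoDual 𝒜 (n + 2)) :
    Module.Dual k (𝒜 1) ⊗[k] Module.Dual k (𝒜 1) →ₗ[k] CoDual 𝒜 n :=
  TensorProduct.lift ((codualLeftHom 𝒜 n).flip ∘ₗ (codualLeftHom 𝒜 (n + 1)).flip c).flip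

@[simp] theorem codualLeft₂_tmul (n : ℕ) (c : CoDual 𝒜 (n + 2)) (f g : Module.Dual k (𝒜 1)) :
    codualLeft₂ 𝒜 n c (f ⊗ₜ g) = codualLeft 𝒜 n f (codualLeft 𝒜 (n + 1) g c) := by
  simp [codualLeft₂]

/-- With $c$ extended to a functional $c'$ on all of $A^!$, the value at $y$ is $c'(qy)$, and the
relation $q$ is zero in $A^!$. -/
theorem codualRight₂_eq_zero (n : ℕ) (c : CoDual 𝒜 (n + 2))
    {q : Module.Dual k (𝒜 1) ⊗[k] Module.Dual k (𝒜 1)} (hq : q ∈ quadRelPerp 𝒜) :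
    codualRight₂ 𝒜 n c q = 0 := by
  obtain ⟨c', hc'⟩ := LinearMap.exists_extend c
  ext y
  suffices h : codualRight₂ 𝒜 n c q y =
      c' (LinearMap.mul' k _ (TensorProduct.map (dualGen 𝒜) (dualGen 𝒜) q) * y) by
    rw [h, mul'_map_dualGen_eq_zero 𝒜 hq]; simp
  clear hq
  induction q with
  | zero => simp
  | add a b ha hb => simp only [map_add, LinearMap.add_apply, ha, hb, add_mul]
  | tmul a b => simp [← hc', mul_assoc]

theorem codualLeft₂_eq_zero (n : ℕ) (c : CoDual 𝒜 (n + 2))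
    {q : Module.Dual k (𝒜 1) ⊗[k] Module.Dual k (𝒜 1)} (hq : q ∈ quadRelPerp 𝒜) :
    codualLeft₂ 𝒜 n c q = 0 := by
  obtain ⟨c', hc'⟩ := LinearMap.exists_extend c
  ext y
  suffices h : codualLeft₂ 𝒜 n c q y =
      c' (y * LinearMap.mul' k _ (TensorProduct.map (dualGen 𝒜) (dualGen 𝒜) q)) by
    rw [h, mul'_map_dualGen_eq_zero 𝒜 hq]; simp
  clear hq
  induction q with
  | zero => simp
  | add a b ha hb => simp only [map_add, LinearMap.add_apply, ha, hb, mul_add]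
  | tmul a b => simp [← hc', mul_assoc]

variable {ι : Type*} [Fintype ι] (x : Module.Basis ι k (𝒜 1))

theorem dualDistrib_sum_coord {C : Type*} [AddCommGroup C] [Module k C]
    (B : Module.Dual k (𝒜 1) ⊗[k] Module.Dual k (𝒜 1) →ₗ[k] C)
    (q : Module.Dual k (𝒜 1) ⊗[k] Module.Dual k (𝒜 1)) :
    ∑ l, ∑ m, TensorProduct.dualDistrib k (𝒜 1) (𝒜 1) q (x l ⊗ₜ x m) •
      B (x.coord l ⊗ₜ x.coord m) = B q := by
  have hf : ∀ f : Module.Dual k (𝒜 1), f = ∑ l, f (x l) • x.coord l := by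
    classical
    intro f
    refine x.ext fun i => ?_
    simp
  induction q with
  | zero => simp
  | add a b ha hb => simp only [map_add, LinearMap.add_apply, add_smul, Finset.sum_add_distrib,
      ha, hb]
  | tmul f g =>
    conv_rhs => rw [hf f, hf g]
    simp only [TensorProduct.sum_tmul, TensorProduct.tmul_sum, ← TensorProduct.smul_tmul',
      TensorProduct.tmul_smul, map_sum, map_smul, TensorProduct.dualDistrib_apply, mul_smul]
    simp only [Finset.smul_sum]
    conv_rhs => rw [Finset.sum_comm]
    exact Finset.sum_congr rfl fun l _ => Finset.sum_congr rfl fun m _ => smul_comm _ _ _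

/-- An element of `M ⊗ C` over a field is zero if all functionals on `C` kill it. -/
theorem tmul_eq_zero_of_forall_dual {M C : Type*} [AddCommGroup M] [Module k M]
    [AddCommGroup C] [Module k C] (z : M ⊗[k] C)
    (h : ∀ φ : Module.Dual k C, TensorProduct.rid k M (φ.lTensor M z) = 0) : z = 0 := by
  classical
  let b := Module.Basis.ofVectorSpace k C
  let e := TensorProduct.equivFinsuppOfBasisRight (M := M) b
  apply e.injective
  rw [map_zero]
  ext i
  rw [Finsupp.zero_apply, ← h (b.coord i)]
  clear h
  induction z with
  | zero => simp
  | add a b ha hb => simp only [map_add, Finsupp.add_apply, ha, hb]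
  | tmul m c => simp [e]

/-- This is $Q_2^{\perp\perp}\subseteq Q_2$. As $V$ is finite-dimensional, $V^*\otimes V^*$ is the
whole dual of $V\otimes V$, so a functional separating $t$ from $Q_2$ would be an element of
$Q_2^\perp$. -/
theorem mem_quadRel_of_forall_perp [Module.Finite k (𝒜 1)] {t : 𝒜 1 ⊗[k] 𝒜 1}
    (h : ∀ q ∈ quadRelPerp 𝒜, TensorProduct.dualDistrib k (𝒜 1) (𝒜 1) q t = 0) :
    t ∈ quadRel 𝒜 := by
  by_contra ht
  obtain ⟨f, hf, hle⟩ := Submodule.exists_le_ker_of_notMem (K := k) (V := 𝒜 1 ⊗[k] 𝒜 1)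
    (p := quadRel 𝒜) (v := t) ht
  let q := (TensorProduct.dualDistribEquiv k (𝒜 1) (𝒜 1)).symm f
  have hq : TensorProduct.dualDistrib k (𝒜 1) (𝒜 1) q = f :=
    (TensorProduct.dualDistribEquiv k (𝒜 1) (𝒜 1)).apply_symm_apply f
  refine hf ?_
  rw [← hq]
  refine h q fun s hs => ?_
  rw [hq]
  exact hle hs

/-- `∑ x_l x_m ⊗ x_l^* x_m^*` vanishes in `A ⊗ A^!`. -/
theorem sum_mul_tmul_eq_zero {C : Type*} [AddCommGroup C] [Module k C]
    (B : Module.Dual k (𝒜 1) ⊗[k] Module.Dual k (𝒜 1) →ₗ[k] C)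
    (hB : ∀ q ∈ quadRelPerp 𝒜, B q = 0) :
    ∑ l, ∑ m, ((x l : A) * (x m : A)) ⊗ₜ[k] B (x.coord l ⊗ₜ x.coord m) = 0 := by
  have := Module.Finite.of_basis x
  apply tmul_eq_zero_of_forall_dual
  intro φ
  -- Contracting the sum with `φ` gives the product in $A$ of this tensor. Its pairing with $q\in
  -- Q_2^\perp$ is `φ (B q) = 0`, so it lies in $Q_2^{\perp\perp}=Q_2$.
  have ht : ∑ l, ∑ m, φ (B (x.coord l ⊗ₜ x.coord m)) • (x l ⊗ₜ[k] x m) ∈ quadRel 𝒜 := by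
    apply mem_quadRel_of_forall_perp
    intro q hq
    have := dualDistrib_sum_coord 𝒜 x (φ ∘ₗ B) q
    simp only [map_sum, map_smul]
    rw [LinearMap.comp_apply, hB q hq, map_zero] at this
    rw [← this]
    simp [mul_comm]
  rw [quadRel, LinearMap.mem_ker] at ht
  simpa using ht

end QuadraticDuality

/-! ### Functionals on $A^!$ from one-generator module extensions -/

section Extension

variable {k : Type*} {A : Type*} [Field k] [Ring A] [Algebra k A] (𝒜 : ℕ → Submodule k A)

/-- The right action of `V*` on `∏_m (A^!)^*_m`. -/
def codualShift : Module.Dual k (𝒜 1) →ₗ[k]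
    (∀ m, CoDual 𝒜 m) →ₗ[k] (∀ m, CoDual 𝒜 m) :=
  LinearMap.mk₂ k (fun f u m => codualRight 𝒜 m f (u (m + 1)))
    (fun f g u => funext fun m => congrArg (· (u (m + 1))) (map_add (codualRightHom 𝒜 m) f g))
    (fun r f u => funext fun m => congrArg (· (u (m + 1))) (map_smul (codualRightHom 𝒜 m) r f))
    (fun f _ _ => funext fun m => map_add (codualRight 𝒜 m f) _ _)
    (fun _ f _ => funext fun m => map_smul (codualRight 𝒜 m f) _ _)

@[simp] theorem codualShift_apply (f : Module.Dual k (𝒜 1)) (u : ∀ m, CoDual 𝒜 m) (m : ℕ) :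
    codualShift 𝒜 f u m = codualRight 𝒜 m f (u (m + 1)) := rfl

variable (N : ℕ) (L : Module.Dual k (𝒜 1) →ₗ[k] CoDual 𝒜 N)

/-- The right action of `V*` on `(∏_m (A^!)^*_m) ⊕ k e` with `e · f = L f`. -/
def extendAction : Module.Dual k (𝒜 1) →ₗ[k] Module.End k ((∀ m, CoDual 𝒜 m) × k) :=
  LinearMap.mk₂ k (fun f z => (codualShift 𝒜 f z.1 + z.2 • Pi.single N (L f), 0))
    (by
      intro f g z
      ext1 <;> simp [Pi.single_add, add_add_add_comm])
    (by
      intro r f z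
      ext1
      · simp [Pi.single_smul, smul_comm z.2 r]
      · simp)
    (by
      intro f z w
      ext1 <;> simp [add_smul, add_add_add_comm])
    (by
      intro r f z
      ext1 <;> simp [mul_smul])

@[simp] theorem extendAction_apply (f : Module.Dual k (𝒜 1)) (z : (∀ m, CoDual 𝒜 m) × k) :
    extendAction 𝒜 N L f z = (codualShift 𝒜 f z.1 + z.2 • Pi.single N (L f), 0) := rfl

/-- The action of the tensor algebra defined by `extendAction`. -/
def tensorAction : TensorAlgebra k (Module.Dual k (𝒜 1)) →ₐ[k]
    (Module.End k ((∀ m, CoDual 𝒜 m) × k))ᵐᵒᵖ :=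
  TensorAlgebra.lift k ((MulOpposite.opLinearEquiv k).toLinearMap ∘ₗ extendAction 𝒜 N L)

/-- The map `f ⊗ g ↦ (e · f) · g`. -/
def extendRel : Module.Dual k (𝒜 1) ⊗[k] Module.Dual k (𝒜 1) →ₗ[k] (∀ m, CoDual 𝒜 m) :=
  TensorProduct.lift ((codualShift 𝒜).flip ∘ₗ LinearMap.single k (CoDual 𝒜) N ∘ₗ L)

variable {N L}

/-- A relation already kills the part $\prod_m(A^!)^*_m$, and it kills the new generator $e$ by
`hL`. Hence the extended action factors through $A^!$. The target is the opposite ring because the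
action is on the right. -/
theorem tensorAction_rel (hL : ∀ q ∈ quadRelPerp 𝒜, extendRel 𝒜 N L q = 0)
    {q : Module.Dual k (𝒜 1) ⊗[k] Module.Dual k (𝒜 1)} (hq : q ∈ quadRelPerp 𝒜) :
    tensorAction 𝒜 N L (LinearMap.mul' k _
      (TensorProduct.map (TensorAlgebra.ι k) (TensorAlgebra.ι k) q)) = 0 := by
  apply MulOpposite.unop_injective
  apply LinearMap.ext
  rintro ⟨u, s⟩
  suffices h : ((tensorAction 𝒜 N L (LinearMap.mul' k _
      (TensorProduct.map (TensorAlgebra.ι k) (TensorAlgebra.ι k) q))).unop (u, s)) =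
      ((fun m => codualRight₂ 𝒜 m (u (m + 2)) q) + s • extendRel 𝒜 N L q, 0) by
    rw [h, hL q hq]
    ext1
    · funext m
      simp [codualRight₂_eq_zero 𝒜 m _ hq]
    · simp
  clear hq
  induction q with
  | zero => ext1 <;> simp; rfl
  | add a b ha hb =>
    simp only [map_add, MulOpposite.unop_add, LinearMap.add_apply, ha, hb]
    ext1
    · funext m
      simp only [Prod.fst_add, Pi.add_apply, smul_add]
      abel
    · simp
  | tmul f g =>
    ext1
    · funext m
      simp [tensorAction, extendRel]
    · simp [tensorAction]

/-- The action of `A^!` on `(∏_m (A^!)^*_m) ⊕ k e`. -/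
def dualAction (hL : ∀ q ∈ quadRelPerp 𝒜, extendRel 𝒜 N L q = 0) :
    QuadraticDual 𝒜 →ₐ[k] (Module.End k ((∀ m, CoDual 𝒜 m) × k))ᵐᵒᵖ :=
  RingQuot.liftAlgHom k ⟨tensorAction 𝒜 N L, by
    rintro _ _ ⟨⟨q, hq, rfl⟩, rfl⟩
    rw [tensorAction_rel 𝒜 hL hq, map_zero]⟩

theorem dualAction_dualGen (hL : ∀ q ∈ quadRelPerp 𝒜, extendRel 𝒜 N L q = 0)
    (f : Module.Dual k (𝒜 1)) :
    dualAction 𝒜 hL (dualGen 𝒜 f) = MulOpposite.op (extendAction 𝒜 N L f) := by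
  simp [dualAction, dualGen, tensorAction]

theorem dualAction_dualGen_mul (hL : ∀ q ∈ quadRelPerp 𝒜, extendRel 𝒜 N L q = 0)
    (f : Module.Dual k (𝒜 1)) (y : QuadraticDual 𝒜) (z : (∀ m, CoDual 𝒜 m) × k) :
    (dualAction 𝒜 hL (dualGen 𝒜 f * y)).unop z =
      (dualAction 𝒜 hL y).unop (extendAction 𝒜 N L f z) := by
  simp [dualAction_dualGen]

/-- The module structure remembers the functionals: $(u\cdot y)_0(1)=u_m(y)$. The induction peels
off the leftmost factor, using $u\cdot(fy)=(u\cdot f)\cdot y$ and $(u\cdot f)_m(y)=u_{m+1}(fy)$. -/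
theorem dualAction_apply_inl (hL : ∀ q ∈ quadRelPerp 𝒜, extendRel 𝒜 N L q = 0) {m : ℕ}
    {y : QuadraticDual 𝒜} (hy : y ∈ dualComponent 𝒜 m) (u : ∀ m, CoDual 𝒜 m) :
    ((dualAction 𝒜 hL y).unop (u, 0)).1 0 (dualOne 𝒜) = u m ⟨y, hy⟩ := by
  revert u
  refine Submodule.pow_induction_on_left' (LinearMap.range (dualGen 𝒜))
    (C := fun m y hy => ∀ u : ∀ m, CoDual 𝒜 m,
      ((dualAction 𝒜 hL y).unop (u, 0)).1 0 (dualOne 𝒜) = u m ⟨y, hy⟩) ?_ ?_ ?_ hy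
  · intro r u
    have : (⟨algebraMap k _ r, by
        rw [dualComponent, pow_zero]; exact Submodule.algebraMap_mem r⟩ : dualComponent 𝒜 0) =
        r • dualOne 𝒜 := by
      ext
      simp [dualOne, Algebra.algebraMap_eq_smul_one]
    simp only [this, map_smul]
    simp [Algebra.algebraMap_eq_smul_one]
  · intro y z i hy hz ihy ihz u
    have : (⟨y + z, add_mem hy hz⟩ : dualComponent 𝒜 i) = ⟨y, hy⟩ + ⟨z, hz⟩ := rfl
    simp only [this, map_add, ← ihy, ← ihz]
    simp
  · rintro _ ⟨f, rfl⟩ i y hy ih u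
    rw [dualAction_dualGen_mul, extendAction_apply]
    simp only [zero_smul, add_zero, ih]
    rfl

/-- A linear map `V* → (A^!)^*_N` compatible with the relations is of the form `f ↦ c · f`. -/
theorem exists_codualRight_eq (hL : ∀ q ∈ quadRelPerp 𝒜, extendRel 𝒜 N L q = 0) :
    ∃ c : CoDual 𝒜 (N + 1), ∀ f, codualRight 𝒜 N f c = L f := by
  -- With $e=(0,1)$, put $c_0(y)=(e\cdot y)_0(1)$. Since $e\cdot f=L f$, this gives
  -- $c_0(fy)=(Lf)(y)$ for $y$ of degree $N$.
  let c₀ : QuadraticDual 𝒜 →ₗ[k] k :=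
    LinearMap.applyₗ (dualOne 𝒜) ∘ₗ LinearMap.proj (φ := CoDual 𝒜) 0 ∘ₗ LinearMap.fst k _ k ∘ₗ
      LinearMap.applyₗ (0, 1) ∘ₗ (MulOpposite.opLinearEquiv k).symm.toLinearMap ∘ₗ
        (dualAction 𝒜 hL).toLinearMap
  refine ⟨c₀ ∘ₗ (dualComponent 𝒜 (N + 1)).subtype, fun f => LinearMap.ext fun y => ?_⟩
  have h : c₀ (dualGen 𝒜 f * y) =
      ((dualAction 𝒜 hL (dualGen 𝒜 f * y)).unop (0, 1)).1 0 (dualOne 𝒜) := rfl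
  rw [codualRight_apply, LinearMap.comp_apply, Submodule.subtype_apply, coe_genMulLeft, h,
    dualAction_dualGen_mul, extendAction_apply]
  simp only [map_zero, zero_add, one_smul]
  rw [dualAction_apply_inl 𝒜 hL y.2]
  simp

/-- The component $A^!_{n+1}$ is spanned by the products $fz$ with $f\in V^*$ and $z\in A^!_n$. -/
theorem eq_zero_of_codualRight_eq_zero {n : ℕ} {c : CoDual 𝒜 (n + 1)}
    (h : ∀ f, codualRight 𝒜 n f c = 0) : c = 0 := by
  obtain ⟨c', rfl⟩ := LinearMap.exists_extend c
  ext ⟨y, hy⟩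
  have hy' := hy
  rw [dualComponent, pow_succ'] at hy'
  change c' y = 0
  refine Submodule.mul_induction_on hy' ?_ ?_
  · rintro _ ⟨f, rfl⟩ z hz
    exact LinearMap.congr_fun (h f) ⟨z, hz⟩
  · intro a b ha hb
    rw [map_add, ha, hb, add_zero]

variable {ι : Type*} [Fintype ι] (x : Module.Basis ι k (𝒜 1))

/-- Exactness of `(A^!)^*_{n+2} → V ⊗ (A^!)^*_{n+1} → A_2 ⊗ (A^!)^*_n`. -/
theorem exists_codualRight_coord_eq {n : ℕ} (c : ι → CoDual 𝒜 (n + 1))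
    (h : ∑ l, ∑ m, ((x l : A) * (x m : A)) ⊗ₜ[k] codualRight 𝒜 n (x.coord m) (c l) = 0) :
    ∃ c' : CoDual 𝒜 (n + 2), ∀ l, codualRight 𝒜 (n + 1) (x.coord l) c' = c l := by
  classical
  let L : Module.Dual k (𝒜 1) →ₗ[k] CoDual 𝒜 (n + 1) :=
    ∑ l, LinearMap.smulRight (LinearMap.applyₗ (x l)) (c l)
  have hLf : ∀ f, L f = ∑ l, f (x l) • c l := fun f => by simp [L]
  have hLc : ∀ l, L (x.coord l) = c l := fun l => by
    simp [hLf, Finsupp.single_apply]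
  suffices hL : ∀ q ∈ quadRelPerp 𝒜, extendRel 𝒜 (n + 1) L q = 0 by
    obtain ⟨c', hc'⟩ := exists_codualRight_eq 𝒜 hL
    exact ⟨c', fun l => by rw [hc', hLc]⟩
  intro q hq
  funext m
  rw [← dualDistrib_sum_coord 𝒜 x (extendRel 𝒜 (n + 1) L) q]
  have hE : ∀ f g, extendRel 𝒜 (n + 1) L (f ⊗ₜ g) m =
      codualRight 𝒜 m g (Pi.single (M := CoDual 𝒜) (n + 1) (L f) (m + 1)) := fun f g => rfl
  simp only [Finset.sum_apply, Pi.smul_apply, hE, hLc, Pi.zero_apply]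
  -- $Lf$ sits in degree $n+1$, so $(e\cdot f)\cdot g$ has no component outside degree $n$.
  by_cases hm : m = n
  · subst hm
    simp only [Pi.single_eq_same]
    ext y
    -- Evaluating `h` at `y` says that `t` is a quadratic relation of $A$; the required vanishing at
    -- `y` is the orthogonality of `q` to `t`.
    let t : 𝒜 1 ⊗[k] 𝒜 1 := ∑ l, ∑ j, codualRight 𝒜 m (x.coord j) (c l) y • (x l ⊗ₜ[k] x j)
    have ht : t ∈ quadRel 𝒜 := by
      rw [quadRel, LinearMap.mem_ker]
      have := congrArg (fun z => TensorProduct.rid k A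
        ((Module.Dual.eval k (dualComponent 𝒜 m) y).lTensor A z)) h
      simpa [t] using this
    have := hq t ht
    simp only [t, map_sum, map_smul, smul_eq_mul] at this
    simp only [LinearMap.sum_apply, LinearMap.smul_apply, smul_eq_mul, LinearMap.zero_apply]
    exact Eq.trans (Finset.sum_congr rfl fun l _ => Finset.sum_congr rfl fun j _ =>
      mul_comm _ _) this
  · have : ∀ l, Pi.single (M := CoDual 𝒜) (n + 1) (c l) (m + 1) = 0 := fun l =>
      Pi.single_eq_of_ne (by omega) _
    simp [this]

/-- Surjectivity of `(A^!)^*_1 → V ⊗ (A^!)^*_0`. -/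
theorem exists_codualRight_coord_eq_zero (c : ι → CoDual 𝒜 0) :
    ∃ c' : CoDual 𝒜 1, ∀ l, codualRight 𝒜 0 (x.coord l) c' = c l := by
  classical
  let L : Module.Dual k (𝒜 1) →ₗ[k] CoDual 𝒜 0 :=
    ∑ l, LinearMap.smulRight (LinearMap.applyₗ (x l)) (c l)
  have hLc : ∀ l, L (x.coord l) = c l := fun l => by
    simp [L, Finsupp.single_apply]
  suffices hL : ∀ q ∈ quadRelPerp 𝒜, extendRel 𝒜 0 L q = 0 by
    obtain ⟨c', hc'⟩ := exists_codualRight_eq 𝒜 hL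
    exact ⟨c', fun l => by rw [hc', hLc]⟩
  -- $Lf$ has degree $0$ and a further action of $V^*$ kills it, so the compatibility with the
  -- relations is automatic.
  have : extendRel 𝒜 0 L = 0 := by
    ext f g m : 4
    simp [extendRel]
  simp [this]

theorem eq_zero_of_codualRight_coord_eq_zero {n : ℕ} {c : CoDual 𝒜 (n + 1)}
    (h : ∀ l, codualRight 𝒜 n (x.coord l) c = 0) : c = 0 := by
  apply eq_zero_of_codualRight_eq_zero
  have : (codualRightHom 𝒜 n).flip c = 0 := by
    classical
    refine x.dualBasis.ext fun i => ?_
    simpa using h i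
  exact fun f => LinearMap.congr_fun this f

/-- The counit `(A^!)^*_0 → k` is bijective. -/
theorem codual_zero_injective {c : CoDual 𝒜 0} (h : c (dualOne 𝒜) = 0) : c = 0 := by
  ext ⟨y, hy⟩
  have hy' := hy
  rw [dualComponent, pow_zero, Submodule.mem_one] at hy'
  obtain ⟨r, rfl⟩ := hy'
  have : (⟨algebraMap k _ r, hy⟩ : dualComponent 𝒜 0) = r • dualOne 𝒜 := by
    ext
    simp [dualOne, Algebra.algebraMap_eq_smul_one]
  simp [this, h]

/-- The point is $1\ne0$ in $A^!$: in the extension with $L=0$, the unit fixes the nonzero vector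
$e$. -/
theorem exists_codual_zero (r : k) : ∃ c : CoDual 𝒜 0, c (dualOne 𝒜) = r := by
  have hne : dualOne 𝒜 ≠ 0 := by
    intro h
    have hL : ∀ q ∈ quadRelPerp 𝒜, extendRel 𝒜 0 0 q = 0 := by
      have : extendRel 𝒜 0 0 = 0 := by
        ext f g m : 4
        simp [extendRel]
      simp [this]
    have h1 : (1 : QuadraticDual 𝒜) = 0 := congrArg Subtype.val h
    have h2 := congrArg (fun y => ((dualAction 𝒜 hL y).unop (0, 1)).2) h1
    simp at h2
  obtain ⟨c, hc, -⟩ := Submodule.exists_le_ker_of_notMem (p := (⊥ : Submodule k _))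
    (v := dualOne 𝒜) (by simpa using hne)
  exact ⟨(r / c (dualOne 𝒜)) • c, by simp [hc]⟩

end Extension

/-! ### Homogeneous components -/

section HomogeneousComponents

variable {k : Type*} [Field k] {M : Type*} [AddCommGroup M] [Module k M]
  {ℳ : ℕ → Submodule k M}

/-- The homogeneous component of degree `N`, for an internal direct sum decomposition. -/
def homogComp (h : DirectSum.IsInternal ℳ) (N : ℕ) : M →ₗ[k] M :=
  (ℳ N).subtype ∘ₗ DirectSum.component k ℕ (fun i => ℳ i) N ∘ₗ
    (LinearEquiv.ofBijective (DirectSum.coeLinearMap ℳ) h).symm.toLinearMap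

theorem homogComp_mem (h : DirectSum.IsInternal ℳ) (N : ℕ) (z : M) : homogComp h N z ∈ ℳ N :=
  Submodule.coe_mem _

theorem homogComp_of_mem (h : DirectSum.IsInternal ℳ) {n : ℕ} {z : M} (hz : z ∈ ℳ n) (N : ℕ) :
    homogComp h N z = if n = N then z else 0 := by
  have : (LinearEquiv.ofBijective (DirectSum.coeLinearMap ℳ) h).symm z =
      DirectSum.lof k ℕ (fun i => ℳ i) n ⟨z, hz⟩ := by
    rw [LinearEquiv.symm_apply_eq]
    exact (DirectSum.coeLinearMap_lof ℳ n ⟨z, hz⟩).symm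
  simp only [homogComp, LinearMap.comp_apply, LinearEquiv.coe_coe, this]
  split_ifs with hn
  · subst hn
    simp
  · rw [DirectSum.component.of, dif_neg hn]
    simp

theorem homogComp_self (h : DirectSum.IsInternal ℳ) {n : ℕ} {z : M} (hz : z ∈ ℳ n) :
    homogComp h n z = z := by
  rw [homogComp_of_mem h hz, if_pos rfl]

theorem map_homogComp {M' : Type*} [AddCommGroup M'] [Module k M'] {ℳ' : ℕ → Submodule k M'}
    (h : DirectSum.IsInternal ℳ) (h' : DirectSum.IsInternal ℳ') (d : M →ₗ[k] M')
    (hd : ∀ N, ∀ z ∈ ℳ N, d z ∈ ℳ' N) (N : ℕ) (z : M) :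
    d (homogComp h N z) = homogComp h' N (d z) := by
  have hz : z ∈ iSup ℳ := by rw [h.submodule_iSup_eq_top]; trivial
  induction hz using Submodule.iSup_induction' with
  | mem n z hz =>
    rw [homogComp_of_mem h hz, homogComp_of_mem h' (hd n z hz)]
    split_ifs <;> simp
  | zero => simp
  | add a b _ _ ha hb => simp only [map_add, ha, hb]

end HomogeneousComponents

/-! ### Graded free modules generated in a single degree -/

section LinearModules

variable {k : Type*} {A : Type*} [Field k] [Ring A] [Algebra k A]

/-- The `A`-linear map `A ⊗ C → P` extending a `k`-linear map `C → P`. -/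
def extendScalars {C P : Type*} [AddCommGroup C] [Module k C] [AddCommGroup P] [Module k P]
    [Module A P] [IsScalarTower k A P] (ψ : C →ₗ[k] P) : A ⊗[k] C →ₗ[A] P :=
  TensorProduct.AlgebraTensorModule.lift
    { toFun := fun y => (Algebra.lsmul k k P y) ∘ₗ ψ
      map_add' := fun y z => by ext; simp
      map_smul' := fun y z => by ext; simp }

@[simp] theorem extendScalars_tmul {C P : Type*} [AddCommGroup C] [Module k C] [AddCommGroup P]
    [Module k P] [Module A P] [IsScalarTower k A P] (ψ : C →ₗ[k] P) (y : A) (c : C) :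
    extendScalars ψ (y ⊗ₜ[k] c) = y • ψ c := rfl

variable {𝒜 : ℕ → Submodule k A}

theorem IsStandardGraded.nontrivial (hA : IsStandardGraded 𝒜) : Nontrivial A :=
  hA.algebraMap_injective.nontrivial

theorem IsStandardGraded.exists_algebraMap_eq (hA : IsStandardGraded 𝒜) {y : A}
    (hy : y ∈ 𝒜 0) : ∃ r : k, algebraMap k A r = y := by
  have : y ∈ (𝒜 0 : Set A) := hy
  rwa [hA.zero_eq] at this

variable {P : Type*} [AddCommGroup P] [Module k P] [Module A P] [IsScalarTower k A P]
  {ℳ : ℕ → Submodule k P}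

theorem extendScalars_surjective {C : Type*} [AddCommGroup C] [Module k C] {ψ : C →ₗ[k] P} {i : ℕ}
    (hψ : LinearMap.range ψ = ℳ i) (hs : Submodule.span A (ℳ i : Set P) = ⊤) :
    Function.Surjective (extendScalars (A := A) ψ) := by
  rw [← LinearMap.range_eq_top, ← top_le_iff, ← hs, Submodule.span_le, ← hψ]
  rintro _ ⟨c, rfl⟩
  exact ⟨1 ⊗ₜ c, by simp⟩

variable [GradedAlgebra 𝒜]

theorem IsGradedFree.homogComp_smul (h : IsGradedFree 𝒜 ℳ) {i : ℕ} {w : P} (hw : w ∈ ℳ i)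
    (y : A) (N : ℕ) : homogComp h.isInternal N (y • w) =
      if i ≤ N then GradedAlgebra.proj 𝒜 (N - i) y • w else 0 := by
  induction y using DirectSum.Decomposition.inductionOn 𝒜 with
  | zero => simp
  | @homogeneous p y =>
    rw [homogComp_of_mem _ (h.smul_mem p i y w y.2 hw), GradedAlgebra.proj_apply,
      DirectSum.decompose_coe]
    by_cases hN : p + i = N
    · subst hN
      rw [if_pos rfl, if_pos (Nat.le_add_left i p), Nat.add_sub_cancel, DirectSum.of_eq_same]
    · rw [if_neg hN]
      split_ifs
      · rw [DirectSum.of_eq_of_ne _ _ _ (by omega)]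
        simp
      · rfl
  | add a b ha hb =>
    rw [add_smul, map_add, ha, hb]
    split_ifs <;> simp [add_smul]

/-- Multiplication by $A$ never lowers degrees. In a linear resolution this makes $d$ injective on
the generating degree: $P_{n+1}$ has nothing in degree $n$, so no nonzero element of $(P_n)_n$ is a
boundary. -/
theorem IsGradedFree.eq_zero_of_lt (h : IsGradedFree 𝒜 ℳ) {i N : ℕ}
    (hs : Submodule.span A (ℳ i : Set P) = ⊤) (hN : N < i) {z : P} (hz : z ∈ ℳ N) : z = 0 := by
  rw [← homogComp_self h.isInternal hz]
  obtain ⟨t, rfl⟩ := extendScalars_surjective (A := A) (ψ := (ℳ i).subtype) (by simp) hs z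
  clear hz
  induction t with
  | zero => simp
  | add a b ha hb => rw [map_add, map_add, ha, hb, add_zero]
  | tmul y w =>
    rw [extendScalars_tmul, Submodule.subtype_apply, h.homogComp_smul w.2,
      if_neg (by omega)]

/-- In a degree $n\ne i$, every element is a combination of elements of degree $i$ with coefficients
in $A_{n-i}$, or zero if $n<i$. So its coordinates have zero constant term, whereas the coordinate
of `b s` at `s` is $1$. -/
theorem IsGradedFree.basis_mem (hA : IsStandardGraded 𝒜) (h : IsGradedFree 𝒜 ℳ) {i : ℕ}
    (hs : Submodule.span A (ℳ i : Set P) = ⊤) {S : Type*} (b : Module.Basis S A P) {s : S} {n : ℕ}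
    (hn : b s ∈ ℳ n) : n = i := by
  by_contra hne
  have := hA.nontrivial
  have key : ∀ t : A ⊗[k] ℳ i, GradedRing.projZeroRingHom 𝒜
      (b.coord s (homogComp h.isInternal n (extendScalars (ℳ i).subtype t))) = 0 := by
    intro t
    induction t with
    | zero => simp
    | add a b ha hb => rw [map_add, map_add, map_add, map_add, ha, hb, add_zero]
    | tmul y w =>
      rw [extendScalars_tmul, Submodule.subtype_apply, h.homogComp_smul w.2]
      split_ifs with hle
      · rw [map_smul, smul_eq_mul, map_mul]
        convert zero_mul _
        rw [GradedRing.projZeroRingHom_apply, GradedAlgebra.proj_apply,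
          DirectSum.decompose_of_mem_ne 𝒜 (SetLike.coe_mem _) (by omega)]
      · simp
  obtain ⟨t, ht⟩ := extendScalars_surjective (A := A) (ψ := (ℳ i).subtype) (by simp) hs (b s)
  have h1 := key t
  rw [ht, homogComp_self _ hn, Module.Basis.coord_apply, Module.Basis.repr_self,
    Finsupp.single_eq_same, map_one] at h1
  exact one_ne_zero h1

theorem IsGradedFree.coord_mem (h : IsGradedFree 𝒜 ℳ) {i : ℕ} {S : Type*}
    (b : Module.Basis S A P) (hb : ∀ s, b s ∈ ℳ i) {w : P} (hw : w ∈ ℳ i) (s : S) :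
    b.coord s w ∈ 𝒜 0 := by
  have key : ∀ l : S →₀ A, b.coord s (homogComp h.isInternal i (Finsupp.linearCombination A b l)) =
      GradedAlgebra.proj 𝒜 0 (l s) := by
    intro l
    induction l using Finsupp.induction_linear with
    | zero => simp
    | add l₁ l₂ h₁ h₂ => rw [map_add, map_add, map_add, h₁, h₂, Finsupp.add_apply, map_add]
    | single s' a =>
      classical
      rw [Finsupp.linearCombination_single, h.homogComp_smul (hb s'), if_pos le_rfl,
        Nat.sub_self, map_smul, Module.Basis.coord_apply, Module.Basis.repr_self]
      by_cases hs : s' = s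
      · subst hs
        simp
      · simp [Finsupp.single_eq_of_ne' hs]
  have := key (b.repr w)
  rw [b.linearCombination_repr, homogComp_self h.isInternal hw] at this
  rw [this, GradedAlgebra.proj_apply]
  exact SetLike.coe_mem _

/-- A homogeneous basis lies entirely in degree $i$, and elements of degree $i$ have coordinates in
$A_0=k$. So the basis comes from vectors `g s` spanning $C$ over $k$, and `b s ↦ 1 ⊗ g s` defines a
left inverse. -/
theorem extendScalars_bijective (hA : IsStandardGraded 𝒜) (h : IsGradedFree 𝒜 ℳ) {i : ℕ}
    (hs : Submodule.span A (ℳ i : Set P) = ⊤) {C : Type*} [AddCommGroup C] [Module k C]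
    {ψ : C →ₗ[k] P} (hψi : Function.Injective ψ) (hψ : LinearMap.range ψ = ℳ i) :
    Function.Bijective (extendScalars (A := A) ψ) := by
  refine ⟨?_, extendScalars_surjective hψ hs⟩
  obtain ⟨S, b, hb⟩ := h.exists_basis
  have hb' : ∀ s, ∃ c, ψ c = b s := fun s => by
    obtain ⟨n, hn⟩ := hb s
    have : b s ∈ LinearMap.range ψ := by
      rw [hψ, ← h.basis_mem hA hs b hn]
      exact hn
    exact this
  choose g hg using hb'
  let ν : P →ₗ[A] A ⊗[k] C := b.constr ℕ fun s => 1 ⊗ₜ g s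
  have hν : ∀ t, ν (extendScalars ψ t) = t := by
    intro t
    induction t with
    | zero => simp
    | add a b ha hb => rw [map_add, map_add, ha, hb]
    | tmul y c =>
      rw [extendScalars_tmul, map_smul]
      have hc : ∀ s, ∃ r : k, algebraMap k A r = b.repr (ψ c) s := fun s =>
        hA.exists_algebraMap_eq (h.coord_mem b (fun s => by
          rw [← hψ, ← hg]; exact ⟨_, rfl⟩) (by rw [← hψ]; exact ⟨c, rfl⟩) s)
      choose r hr using hc
      have hsum : c = ∑ s ∈ (b.repr (ψ c)).support, r s • g s := by
        apply hψi
        conv_lhs => rw [← b.linearCombination_repr (ψ c)]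
        rw [Finsupp.linearCombination_apply, Finsupp.sum]
        simp [hg, ← hr]
      have : ν (ψ c) = 1 ⊗ₜ c := by
        conv_rhs => rw [hsum]
        rw [Module.Basis.constr_apply, Finsupp.sum, TensorProduct.tmul_sum]
        refine Finset.sum_congr rfl fun s _ => ?_
        rw [← hr, algebraMap_smul, TensorProduct.tmul_smul]
      rw [this, TensorProduct.smul_tmul', smul_eq_mul, mul_one]
  exact Function.LeftInverse.injective hν

end LinearModules

/-! ### The Koszul complex -/

section KoszulComplex

variable {k : Type*} {A : Type*} [Field k] [Ring A] [Algebra k A] (𝒜 : ℕ → Submodule k A)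
  {ι : Type*} [Fintype ι] (x : Module.Basis ι k (𝒜 1))

/-- The differential of the Koszul complex `A ⊗ (A^!)^*_n`. -/
def koszulDiff (n : ℕ) : A ⊗[k] CoDual 𝒜 (n + 1) →ₗ[A] A ⊗[k] CoDual 𝒜 n :=
  ∑ l, TensorProduct.AlgebraTensorModule.map (LinearMap.toSpanSingleton A A (x l : A))
    (codualRight 𝒜 n (x.coord l))

@[simp] theorem koszulDiff_tmul (n : ℕ) (y : A) (c : CoDual 𝒜 (n + 1)) :
    koszulDiff 𝒜 x n (y ⊗ₜ c) = ∑ l, (y * x l) ⊗ₜ codualRight 𝒜 n (x.coord l) c := by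
  simp [koszulDiff]

theorem koszulDiff_comp (n : ℕ) (c : CoDual 𝒜 (n + 2)) :
    koszulDiff 𝒜 x n (koszulDiff 𝒜 x (n + 1) (1 ⊗ₜ c)) = 0 := by
  simpa using sum_mul_tmul_eq_zero 𝒜 x (codualRight₂ 𝒜 n c)
    fun q hq => codualRight₂_eq_zero 𝒜 n c hq

/-- The $x_l$ are independent in $A$, so each $c\cdot x_l^*$ vanishes, and these determine $c$. -/
theorem koszulDiff_one_tmul_injective (n : ℕ) {c : CoDual 𝒜 (n + 1)}
    (h : koszulDiff 𝒜 x n (1 ⊗ₜ c) = 0) : c = 0 := by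
  apply eq_zero_of_codualRight_coord_eq_zero 𝒜 x
  simp only [koszulDiff_tmul, one_mul] at h
  have hx : LinearIndependent k (fun l => (x l : A)) :=
    x.linearIndependent.map' (𝒜 1).subtype (𝒜 1).ker_subtype
  intro l
  ext y
  have h' := congrArg (fun z => TensorProduct.rid k A
    ((Module.Dual.eval k (dualComponent 𝒜 n) y).lTensor A z)) h
  simp only [map_sum, LinearMap.lTensor_tmul, TensorProduct.rid_tmul, map_zero] at h'
  exact Fintype.linearIndependent_iff.mp hx _ h' l

variable [GradedAlgebra 𝒜]

/-- The augmentation `A ⊗ (A^!)^*_0 → k` of the Koszul complex. -/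
def koszulAug : A ⊗[k] CoDual 𝒜 0 →ₗ[A] A ⧸ maxIdeal 𝒜 :=
  extendScalars ((LinearMap.toSpanSingleton k (A ⧸ maxIdeal 𝒜) (Submodule.Quotient.mk 1)) ∘ₗ
    Module.Dual.eval k (dualComponent 𝒜 0) (dualOne 𝒜))

@[simp] theorem koszulAug_tmul (y : A) (c : CoDual 𝒜 0) :
    koszulAug 𝒜 (y ⊗ₜ c) = Submodule.Quotient.mk (c (dualOne 𝒜) • y) := by
  rw [koszulAug, extendScalars_tmul]
  change Submodule.Quotient.mk (y • c (dualOne 𝒜) • (1 : A)) = _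
  rw [smul_eq_mul, mul_smul_comm, mul_one]

end KoszulComplex

/-! ### Comparison of a linear resolution with the Koszul complex -/

section Comparison

variable {k : Type*} [Field k]

/-- Since $d$ maps $W$ isomorphically onto the image of $f$, inverting it on that image lifts $f$.
It is applied with $W$ the generating degree of a term of the linear resolution. -/
theorem exists_injective_range_eq {C P Q : Type*} [AddCommGroup C] [Module k C] [AddCommGroup P]
    [Module k P] [AddCommGroup Q] [Module k Q] (f : C →ₗ[k] Q) (hf : Function.Injective f)
    (d : P →ₗ[k] Q) (W : Submodule k P) (hd : ∀ w ∈ W, d w = 0 → w = 0)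
    (h : W.map d = LinearMap.range f) :
    ∃ ψ : C →ₗ[k] P, Function.Injective ψ ∧ LinearMap.range ψ = W ∧ ∀ c, d (ψ c) = f c := by
  have hg : Function.Injective (d.domRestrict W) := by
    rw [injective_iff_map_eq_zero]
    rintro ⟨w, hw⟩ h0
    exact Subtype.ext (hd w hw h0)
  have hr : LinearMap.range f = LinearMap.range (d.domRestrict W) := by
    rw [← h, LinearMap.range_domRestrict]
  let e : C ≃ₗ[k] W := (LinearEquiv.ofInjective f hf).trans
    ((LinearEquiv.ofEq _ _ hr).trans (LinearEquiv.ofInjective _ hg).symm)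
  refine ⟨W.subtype ∘ₗ e.toLinearMap, ?_, ?_, fun c => ?_⟩
  · exact Subtype.val_injective.comp e.injective
  · rw [LinearMap.range_comp]
    simp
  · have : LinearEquiv.ofInjective _ hg (e c) = LinearEquiv.ofEq _ _ hr
        (LinearEquiv.ofInjective f hf c) := by simp [e]
    exact congrArg Subtype.val this

variable {A : Type*} [Ring A] [Algebra k A] {𝒜 : ℕ → Submodule k A} [GradedAlgebra 𝒜]
  {ι : Type*} [Fintype ι] (x : Module.Basis ι k (𝒜 1))
  {P : ℕ → Type*} [∀ n, AddCommGroup (P n)] [∀ n, Module k (P n)] [∀ n, Module A (P n)]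
  [∀ n, IsScalarTower k A (P n)] {grP : ∀ n, ℕ → Submodule k (P n)}
  {d : ∀ n, P (n + 1) →ₗ[A] P n}

theorem IsGradedFree.exists_sum_of_mem {M : Type*} [AddCommGroup M] [Module k M] [Module A M]
    [IsScalarTower k A M] {ℳ : ℕ → Submodule k M} (h : IsGradedFree 𝒜 ℳ) {i : ℕ}
    (hs : Submodule.span A (ℳ i : Set M) = ⊤) {C : Type*} [AddCommGroup C] [Module k C]
    {ψ : C →ₗ[k] M} (hψ : LinearMap.range ψ = ℳ i) {z : M} (hz : z ∈ ℳ (i + 1)) :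
    ∃ c : ι → C, z = extendScalars ψ (∑ l, (x l : A) ⊗ₜ[k] c l) := by
  obtain ⟨t, rfl⟩ := extendScalars_surjective (A := A) hψ hs z
  rw [← homogComp_self h.isInternal hz]
  clear hz
  induction t with
  | zero => exact ⟨0, by simp⟩
  | add a b ha hb =>
    obtain ⟨c, hc⟩ := ha
    obtain ⟨c', hc'⟩ := hb
    exact ⟨c + c', by
      simp only [map_add, hc, hc', Pi.add_apply, TensorProduct.tmul_add, Finset.sum_add_distrib]⟩
  | tmul y c =>
    rw [extendScalars_tmul, h.homogComp_smul (by rw [← hψ]; exact ⟨c, rfl⟩),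
      if_pos (Nat.le_succ i), Nat.add_sub_cancel_left]
    have hy : GradedAlgebra.proj 𝒜 1 y ∈ 𝒜 1 := by
      rw [GradedAlgebra.proj_apply]; exact SetLike.coe_mem _
    refine ⟨fun l => x.repr ⟨_, hy⟩ l • c, ?_⟩
    have : GradedAlgebra.proj 𝒜 1 y = ∑ l, x.repr ⟨_, hy⟩ l • (x l : A) := by
      have := congrArg Subtype.val (x.sum_repr ⟨_, hy⟩)
      simp only [AddSubmonoidClass.coe_finsetSum, Submodule.coe_smul] at this
      exact this.symm
    conv_lhs => rw [this]
    simp only [map_sum, extendScalars_tmul, map_smul, Finset.sum_smul, smul_assoc]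
    refine Finset.sum_congr rfl fun l _ => ?_
    rw [smul_algebra_smul_comm]

theorem map_extendScalars_of_forall {C C' Q R : Type*} [AddCommGroup C] [Module k C]
    [AddCommGroup C'] [Module A C'] [AddCommGroup Q] [Module k Q] [Module A Q]
    [IsScalarTower k A Q] [AddCommGroup R] [Module A R]
    {ψ : C →ₗ[k] Q} {δ : Q →ₗ[A] R} {Φ : C' →ₗ[A] R} {g : A ⊗[k] C →ₗ[A] C'}
    (h : ∀ c, δ (ψ c) = Φ (g (1 ⊗ₜ c))) (t : A ⊗[k] C) :
    δ (extendScalars ψ t) = Φ (g t) := by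
  induction t with
  | zero => simp
  | add a b ha hb => simp only [map_add, ha, hb]
  | tmul y c =>
    rw [extendScalars_tmul, map_smul, h, ← map_smul, ← map_smul, TensorProduct.smul_tmul',
      smul_eq_mul, mul_one]

/-- One step of the comparison of a linear resolution with the Koszul complex. -/
theorem exists_comparison_of_range (hgr : ∀ n, IsGradedFree 𝒜 (grP n))
    (hd : ∀ n N z, z ∈ grP (n + 1) N → d n z ∈ grP n N)
    (hex : ∀ n, Function.Exact (d (n + 1)) (d n))
    (hs : ∀ i, Submodule.span A (grP i i : Set (P i)) = ⊤) (hA : IsStandardGraded 𝒜) (n : ℕ)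
    (ψ : CoDual 𝒜 n →ₗ[k] P n) (h : Function.Injective ψ) (h' : LinearMap.range ψ = grP n n)
    (hr : ∀ c : ι → CoDual 𝒜 n, extendScalars ψ (∑ l, (x l : A) ⊗ₜ[k] c l) ∈ Set.range (d n) →
      ∃ c', ∀ l, codualRight 𝒜 n (x.coord l) c' = c l)
    (hr' : ∀ c, extendScalars ψ (koszulDiff 𝒜 x n (1 ⊗ₜ c)) ∈ Set.range (d n)) :
    ∃ ψ' : CoDual 𝒜 (n + 1) →ₗ[k] P (n + 1), Function.Injective ψ' ∧
      LinearMap.range ψ' = grP (n + 1) (n + 1) ∧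
      ∀ c, d n (ψ' c) = extendScalars ψ (koszulDiff 𝒜 x n (1 ⊗ₜ c)) := by
  let f : CoDual 𝒜 (n + 1) →ₗ[k] P n :=
    (extendScalars ψ).restrictScalars k ∘ₗ (koszulDiff 𝒜 x n).restrictScalars k ∘ₗ
      TensorProduct.mk k A _ 1
  have hf : ∀ c, f c = extendScalars ψ (koszulDiff 𝒜 x n (1 ⊗ₜ c)) := fun c => rfl
  refine exists_injective_range_eq f ?_ ((d n).restrictScalars k) _ ?_ ?_
  · rw [injective_iff_map_eq_zero]
    intro c h0
    apply koszulDiff_one_tmul_injective 𝒜 x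
    exact (extendScalars_bijective hA (hgr n) (hs n) h h').injective (by rw [map_zero, ← hf, h0])
  -- A cycle in $(P_{n+1})_{n+1}$ is the image of an element of $(P_{n+2})_{n+1}$, which is zero
  -- because $P_{n+2}$ starts in degree $n+2$.
  · intro w hw h0
    obtain ⟨u, rfl⟩ := (hex n w).mp h0
    rw [← homogComp_self (hgr (n + 1)).isInternal hw]
    have := map_homogComp (hgr (n + 2)).isInternal (hgr (n + 1)).isInternal
      ((d (n + 1)).restrictScalars k) (hd (n + 1)) (n + 1) u
    simp only [LinearMap.coe_restrictScalars] at this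
    rw [← this, (hgr (n + 2)).eq_zero_of_lt (hs (n + 2)) (by omega) (homogComp_mem _ _ _), map_zero]
  · ext z
    constructor
    · rintro ⟨w, hw, rfl⟩
      have hz := hd n _ _ hw
      simp only [LinearMap.coe_restrictScalars]
      obtain ⟨c, hc⟩ := (hgr n).exists_sum_of_mem x (hs n) h' hz
      obtain ⟨c', hc'⟩ := hr c ⟨w, hc⟩
      refine ⟨c', ?_⟩
      rw [hf, koszulDiff_tmul, hc]
      simp [hc']
    · rintro ⟨c, rfl⟩
      have hmem : f c ∈ grP n (n + 1) := by
        rw [hf, koszulDiff_tmul, map_sum]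
        refine Submodule.sum_mem _ fun l _ => ?_
        rw [extendScalars_tmul, one_mul]
        have := (hgr n).smul_mem 1 n _ (ψ (codualRight 𝒜 n (x.coord l) c)) (x l).2
          (by rw [← h']; exact ⟨_, rfl⟩)
        rwa [add_comm 1 n] at this
      obtain ⟨u, hu⟩ := hr' c
      -- As `f c` has degree $n+1$, the component of degree $n+1$ of any preimage is again a
      -- preimage.
      refine ⟨homogComp (hgr (n + 1)).isInternal (n + 1) u, homogComp_mem _ _ _, ?_⟩
      rw [map_homogComp _ (hgr n).isInternal _ (hd n)]
      simp only [LinearMap.coe_restrictScalars]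
      rw [hu, ← hf, homogComp_self _ hmem]

/-- By exactness, $\sum x_l\otimes c_l$ maps to a boundary if and only if $\sum x_lx_m\otimes
c_l\cdot x_m^*=0$, after transport along $\psi_0$ and $\psi_1$. This is the condition cutting
$(A^!)^*_{n+2}$ out of $V\otimes(A^!)^*_{n+1}$. -/
theorem exists_comparison_succ (hA : IsStandardGraded 𝒜)
    (hgr : ∀ n, IsGradedFree 𝒜 (grP n)) (hd : ∀ n N z, z ∈ grP (n + 1) N → d n z ∈ grP n N)
    (hex : ∀ n, Function.Exact (d (n + 1)) (d n))
    (hs : ∀ i, Submodule.span A (grP i i : Set (P i)) = ⊤) (n : ℕ)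
    (ψ₀ : CoDual 𝒜 n →ₗ[k] P n) (ψ₁ : CoDual 𝒜 (n + 1) →ₗ[k] P (n + 1))
    (h₀ : Function.Injective ψ₀) (h₀' : LinearMap.range ψ₀ = grP n n)
    (h₁ : Function.Injective ψ₁) (h₁' : LinearMap.range ψ₁ = grP (n + 1) (n + 1))
    (hc : ∀ c, d n (ψ₁ c) = extendScalars ψ₀ (koszulDiff 𝒜 x n (1 ⊗ₜ c))) :
    ∃ ψ₂ : CoDual 𝒜 (n + 2) →ₗ[k] P (n + 2), Function.Injective ψ₂ ∧
      LinearMap.range ψ₂ = grP (n + 2) (n + 2) ∧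
      ∀ c, d (n + 1) (ψ₂ c) = extendScalars ψ₁ (koszulDiff 𝒜 x (n + 1) (1 ⊗ₜ c)) := by
  have hc' : ∀ t, d n (extendScalars ψ₁ t) = extendScalars ψ₀ (koszulDiff 𝒜 x n t) :=
    map_extendScalars_of_forall hc
  refine exists_comparison_of_range x hgr hd hex hs hA (n + 1) ψ₁ h₁ h₁' ?_ ?_
  · intro c hrange
    have h0 := (hex n _).mpr hrange
    rw [hc'] at h0
    have h0 := (extendScalars_bijective hA (hgr n) (hs n) h₀ h₀').injective
      (h0.trans (map_zero _).symm)
    simp only [map_sum, koszulDiff_tmul] at h0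
    exact exists_codualRight_coord_eq 𝒜 x c h0
  · intro c
    exact (hex n _).mp (by rw [hc', koszulDiff_comp, map_zero])

theorem mem_maxIdeal_iff (y : A) : y ∈ maxIdeal 𝒜 ↔ GradedAlgebra.proj 𝒜 0 y = 0 :=
  HomogeneousIdeal.mem_irrelevant_iff 𝒜 y

theorem mem_maxIdeal_of_mem {n : ℕ} (hn : n ≠ 0) {y : A} (hy : y ∈ 𝒜 n) : y ∈ maxIdeal 𝒜 := by
  rw [mem_maxIdeal_iff, GradedAlgebra.proj_apply, DirectSum.decompose_of_mem_ne 𝒜 hy hn]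

/-- The start of the comparison of a linear resolution with the Koszul complex. -/
theorem exists_comparison_zero (hA : IsStandardGraded 𝒜) {ε : P 0 →ₗ[A] A ⧸ maxIdeal 𝒜}
    (hP : IsGradedFreeResolution 𝒜 grP d (quotGrading 𝒜 (maxIdeal 𝒜)) ε)
    (hs : ∀ i, Submodule.span A (grP i i : Set (P i)) = ⊤) :
    ∃ (ψ₀ : CoDual 𝒜 0 →ₗ[k] P 0) (ψ₁ : CoDual 𝒜 1 →ₗ[k] P 1),
      Function.Injective ψ₀ ∧ LinearMap.range ψ₀ = grP 0 0 ∧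
      (∀ c, ε (ψ₀ c) = koszulAug 𝒜 (1 ⊗ₜ c)) ∧
      Function.Injective ψ₁ ∧ LinearMap.range ψ₁ = grP 1 1 ∧
      ∀ c, d 0 (ψ₁ c) = extendScalars ψ₀ (koszulDiff 𝒜 x 0 (1 ⊗ₜ c)) := by
  -- The module $A/\mathfrak m=k$ is concentrated in degree $0$.
  have hε : ∀ N, N ≠ 0 → ∀ z ∈ grP 0 N, ε z = 0 := by
    intro N hN z hz
    obtain ⟨y, hy, hyz⟩ := hP.ε_mem N z hz
    rw [← hyz]
    exact (Submodule.Quotient.mk_eq_zero _).mpr (mem_maxIdeal_of_mem hN hy)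
  have hε0 : ∀ z, ε (homogComp (hP.gradedFree 0).isInternal 0 z) = ε z := by
    intro z
    have hz : z ∈ iSup (grP 0) := by
      rw [(hP.gradedFree 0).isInternal.submodule_iSup_eq_top]; trivial
    induction hz using Submodule.iSup_induction' with
    | mem n z hz =>
      rw [homogComp_of_mem _ hz]
      split_ifs with hn
      · rfl
      · rw [map_zero, hε n hn z hz]
    | zero => simp
    | add a b _ _ ha hb => simp only [map_add, ha, hb]
  let f : CoDual 𝒜 0 →ₗ[k] A ⧸ maxIdeal 𝒜 :=
    (koszulAug 𝒜).restrictScalars k ∘ₗ TensorProduct.mk k A _ 1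
  have hf : ∀ c, f c = Submodule.Quotient.mk (c (dualOne 𝒜) • (1 : A)) := fun c =>
    koszulAug_tmul 𝒜 1 c
  have := hA.nontrivial
  obtain ⟨ψ₀, h₀, h₀', hψ₀⟩ : ∃ ψ₀ : CoDual 𝒜 0 →ₗ[k] P 0, Function.Injective ψ₀ ∧
      LinearMap.range ψ₀ = grP 0 0 ∧ ∀ c, ε.restrictScalars k (ψ₀ c) = f c := by
    refine exists_injective_range_eq f ?_ (ε.restrictScalars k) _ ?_ ?_
    · rw [injective_iff_map_eq_zero]
      intro c h0
      apply codual_zero_injective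
      rw [hf, Submodule.Quotient.mk_eq_zero, mem_maxIdeal_iff, map_smul, GradedAlgebra.proj_apply,
        DirectSum.decompose_of_mem_same 𝒜 SetLike.GradedOne.one_mem] at h0
      exact (smul_eq_zero.mp h0).resolve_right one_ne_zero
    · intro w hw h0
      obtain ⟨u, rfl⟩ := (hP.exact_ε w).mp h0
      rw [← homogComp_self (hP.gradedFree 0).isInternal hw]
      have := map_homogComp (hP.gradedFree 1).isInternal (hP.gradedFree 0).isInternal
        ((d 0).restrictScalars k) (hP.d_mem 0) 0 u
      simp only [LinearMap.coe_restrictScalars] at this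
      rw [← this, (hP.gradedFree 1).eq_zero_of_lt (hs 1) (by omega) (homogComp_mem _ _ _),
        map_zero]
    · ext z
      constructor
      · rintro ⟨w, hw, rfl⟩
        obtain ⟨y, hy, hyw⟩ := hP.ε_mem 0 w hw
        obtain ⟨r, rfl⟩ := hA.exists_algebraMap_eq hy
        obtain ⟨c, rfl⟩ := exists_codual_zero 𝒜 r
        refine ⟨c, ?_⟩
        rw [hf, ← Algebra.algebraMap_eq_smul_one]
        exact hyw
      · rintro ⟨c, rfl⟩
        obtain ⟨z, hz⟩ := hP.surjective_ε (f c)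
        exact ⟨_, homogComp_mem (hP.gradedFree 0).isInternal 0 z, (hε0 z).trans hz⟩
  -- No condition arises here: $(A^!)^*_1$ is all of $V\otimes(A^!)^*_0$, and all of $(P_0)_1$
  -- consists of boundaries, since `ε` kills it.
  obtain ⟨ψ₁, h⟩ := exists_comparison_of_range x hP.gradedFree hP.d_mem hP.exact_d hs hA 0 ψ₀ h₀ h₀'
    (fun c _ => exists_codualRight_coord_eq_zero 𝒜 x c) (fun c => by
      refine (hP.exact_ε _).mp (hε 1 one_ne_zero _ ?_)
      rw [koszulDiff_tmul, map_sum]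
      refine Submodule.sum_mem _ fun l _ => ?_
      rw [extendScalars_tmul, one_mul]
      exact (hP.gradedFree 0).smul_mem 1 0 _ _ (x l).2 (by rw [← h₀']; exact ⟨_, rfl⟩))
  exact ⟨ψ₀, ψ₁, h₀, h₀', hψ₀, h⟩

theorem koszulDiff_exact (hA : IsStandardGraded 𝒜) (hK : IsKoszul 𝒜) (n : ℕ) :
    Function.Exact (koszulDiff 𝒜 x (n + 1)) (koszulDiff 𝒜 x n) := by
  obtain ⟨P, _, _, _, _, grP, d, ε, hP, hs⟩ := hK
  -- The induction carries two consecutive maps because the recursion for $(A^!)^*_n$ has second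
  -- order.
  have key : ∀ n, ∃ (ψ₀ : CoDual 𝒜 n →ₗ[k] P n) (ψ₁ : CoDual 𝒜 (n + 1) →ₗ[k] P (n + 1)),
      Function.Injective ψ₀ ∧ LinearMap.range ψ₀ = grP n n ∧
      Function.Injective ψ₁ ∧ LinearMap.range ψ₁ = grP (n + 1) (n + 1) ∧
      ∀ c, d n (ψ₁ c) = extendScalars ψ₀ (koszulDiff 𝒜 x n (1 ⊗ₜ c)) := by
    intro n
    induction n with
    | zero =>
      obtain ⟨ψ₀, ψ₁, h₀, h₀', -, h⟩ := exists_comparison_zero x hA hP hs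
      exact ⟨ψ₀, ψ₁, h₀, h₀', h⟩
    | succ n ih =>
      obtain ⟨ψ₀, ψ₁, h₀, h₀', h₁, h₁', hc⟩ := ih
      obtain ⟨ψ₂, h⟩ := exists_comparison_succ x hA hP.gradedFree hP.d_mem hP.exact_d hs n
        ψ₀ ψ₁ h₀ h₀' h₁ h₁' hc
      exact ⟨ψ₁, ψ₂, h₁, h₁', h⟩
  obtain ⟨ψ₀, ψ₁, h₀, h₀', h₁, h₁', hc⟩ := key n
  obtain ⟨ψ₂, h₂, h₂', hc'⟩ := exists_comparison_succ x hA hP.gradedFree hP.d_mem hP.exact_d hs n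
        ψ₀ ψ₁ h₀ h₀' h₁ h₁' hc
  let e (m : ℕ) {ψ : CoDual 𝒜 m →ₗ[k] P m} (h : Function.Injective ψ)
      (h' : LinearMap.range ψ = grP m m) := LinearEquiv.ofBijective (extendScalars (A := A) ψ)
    (extendScalars_bijective hA (hP.gradedFree m) (hs m) h h')
  refine (Function.Exact.iff_of_ladder_linearEquiv (g₁₂ := d (n + 1)) (g₂₃ := d n)
    (e₁ := e _ h₂ h₂') (e₂ := e _ h₁ h₁') (e₃ := e _ h₀ h₀') ?_ ?_).mp (hP.exact_d n)
  · exact LinearMap.ext (map_extendScalars_of_forall hc')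
  · exact LinearMap.ext (map_extendScalars_of_forall hc)

theorem koszulAug_exact (hA : IsStandardGraded 𝒜) (hK : IsKoszul 𝒜) :
    Function.Exact (koszulDiff 𝒜 x 0) (koszulAug 𝒜) := by
  obtain ⟨P, _, _, _, _, grP, d, ε, hP, hs⟩ := hK
  obtain ⟨ψ₀, ψ₁, h₀, h₀', hc₀, h₁, h₁', hc₁⟩ := exists_comparison_zero x hA hP hs
  let e (m : ℕ) {ψ : CoDual 𝒜 m →ₗ[k] P m} (h : Function.Injective ψ)
      (h' : LinearMap.range ψ = grP m m) := LinearEquiv.ofBijective (extendScalars (A := A) ψ)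
    (extendScalars_bijective hA (hP.gradedFree m) (hs m) h h')
  refine (Function.Exact.iff_of_ladder_linearEquiv (g₁₂ := d 0) (g₂₃ := ε)
    (e₁ := e _ h₁ h₁') (e₂ := e _ h₀ h₀') (e₃ := LinearEquiv.refl A _) ?_ ?_).mp hP.exact_ε
  · exact LinearMap.ext (map_extendScalars_of_forall hc₁)
  · exact LinearMap.ext (map_extendScalars_of_forall (Φ := LinearMap.id)
      (g := koszulAug 𝒜) hc₀)

end Comparison

/-! ### $\mathfrak m^a=A_{\ge a}$ -/

section PowersOfMaxIdeal

variable {k : Type*} {A : Type*} [Field k] [Ring A] [Algebra k A] {𝒜 : ℕ → Submodule k A}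
  [GradedAlgebra 𝒜]

theorem proj_mem (n : ℕ) (y : A) : GradedAlgebra.proj 𝒜 n y ∈ 𝒜 n := by
  rw [GradedAlgebra.proj_apply]
  exact SetLike.coe_mem _

theorem proj_of_mem {i : ℕ} {y : A} (hy : y ∈ 𝒜 i) (n : ℕ) :
    GradedAlgebra.proj 𝒜 n y = if i = n then y else 0 := by
  rw [GradedAlgebra.proj_apply]
  split_ifs with h
  · subst h
    exact DirectSum.decompose_of_mem_same 𝒜 hy
  · exact DirectSum.decompose_of_mem_ne 𝒜 hy h

theorem proj_mul_mem (S : Submodule k A) (n : ℕ) (y z : A)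
    (h : ∀ i j, i + j = n → GradedAlgebra.proj 𝒜 i y * GradedAlgebra.proj 𝒜 j z ∈ S) :
    GradedAlgebra.proj 𝒜 n (y * z) ∈ S := by
  classical
  have hyz : y * z = ∑ i ∈ (DirectSum.decompose 𝒜 y).support,
      ∑ j ∈ (DirectSum.decompose 𝒜 z).support,
        GradedAlgebra.proj 𝒜 i y * GradedAlgebra.proj 𝒜 j z := by
    conv_lhs => rw [← DirectSum.sum_support_decompose 𝒜 y, ← DirectSum.sum_support_decompose 𝒜 z]
    rw [Finset.sum_mul_sum]
    rfl
  rw [hyz, map_sum]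
  refine Submodule.sum_mem _ fun i _ => ?_
  rw [map_sum]
  refine Submodule.sum_mem _ fun j _ => ?_
  rw [proj_of_mem (SetLike.GradedMul.mul_mem (proj_mem i y) (proj_mem j z))]
  split_ifs with hij
  · exact h i j hij
  · exact zero_mem _

theorem proj_eq_zero_of_mem_pow {a : ℕ} {y : A} (hy : y ∈ maxIdeal 𝒜 ^ a) {j : ℕ} (hj : j < a) :
    GradedAlgebra.proj 𝒜 j y = 0 := by
  induction a generalizing y j with
  | zero => omega
  | succ a ih =>
    rw [Submodule.pow_succ] at hy
    refine Submodule.mul_induction_on hy (fun r hr s hs => ?_) (fun r s hr hs => ?_)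
    · rw [← Submodule.mem_bot k]
      refine proj_mul_mem _ _ _ _ fun i l hil => ?_
      rw [Submodule.mem_bot]
      rcases Nat.eq_zero_or_pos l with rfl | hl
      · rw [(mem_maxIdeal_iff s).mp hs, mul_zero]
      · rw [ih hr (by omega), zero_mul]
    · rw [map_add, hr, hs, add_zero]

/-- Generation in degree one gives $A_n\subseteq V^n$. Speaking of components of arbitrary elements
lets the induction over the generated algebra pass through sums and products. -/
theorem IsStandardGraded.proj_mem_pow (hA : IsStandardGraded 𝒜) (n : ℕ) (y : A) :
    GradedAlgebra.proj 𝒜 n y ∈ 𝒜 1 ^ n := by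
  have hy : y ∈ Algebra.adjoin k (𝒜 1 : Set A) := by rw [hA.adjoin_eq_top]; trivial
  induction hy using Algebra.adjoin_induction generalizing n with
  | mem y hy =>
    rw [proj_of_mem hy]
    split_ifs with h
    · subst h
      rwa [pow_one]
    · exact zero_mem _
  | algebraMap r =>
    rw [proj_of_mem (SetLike.algebraMap_mem_graded 𝒜 r)]
    split_ifs with h
    · subst h
      rw [pow_zero]
      exact Submodule.algebraMap_mem r
    · exact zero_mem _
  | add y z _ _ hy hz =>
    rw [map_add]
    exact add_mem (hy n) (hz n)
  | mul y z _ _ hy hz =>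
    refine proj_mul_mem _ _ _ _ fun i j hij => ?_
    rw [← hij, pow_add]
    exact Submodule.mul_mem_mul (hy i) (hz j)

theorem IsStandardGraded.mem_pow_of_mem (hA : IsStandardGraded 𝒜) {a n : ℕ} (h : a ≤ n) {y : A}
    (hy : y ∈ 𝒜 n) : y ∈ maxIdeal 𝒜 ^ a := by
  have h0 : ∀ y : A, y ∈ maxIdeal 𝒜 ^ 0 := fun y => by
    rw [Submodule.pow_zero, Submodule.one_eq_span, Submodule.mem_span_singleton]
    exact ⟨y, mul_one y⟩
  have key : ∀ n, ∀ y ∈ 𝒜 1 ^ n, y ∈ maxIdeal 𝒜 ^ n := by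
    intro n
    induction n with
    | zero => exact fun y _ => h0 y
    | succ n ih =>
      intro y hy
      rw [pow_succ] at hy
      rw [Submodule.pow_succ]
      refine Submodule.mul_induction_on hy (fun r hr s hs => ?_) (fun r s hr hs => add_mem hr hs)
      exact Submodule.mul_mem_mul (ih r hr) (mem_maxIdeal_of_mem one_ne_zero hs)
  rcases eq_or_ne a 0 with rfl | ha
  · exact h0 y
  have hy' := key n y (by simpa only [proj_of_mem hy, if_true] using hA.proj_mem_pow n y)
  -- Now $n=m+a$, and in $\mathfrak m^m\mathfrak m^a$ the left ideal $\mathfrak m^a$ stands on the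
  -- right and absorbs the other factor.
  obtain ⟨m, rfl⟩ := Nat.exists_eq_add_of_le' h
  rw [Submodule.pow_add _ ha] at hy'
  exact Submodule.mul_induction_on hy' (fun r _ s hs => Ideal.mul_mem_left _ r hs)
    fun r s hr hs => add_mem hr hs

theorem sum_proj_sub_mem (hA : IsStandardGraded 𝒜) (a : ℕ) (y : A) :
    y - ∑ j : Fin a, GradedAlgebra.proj 𝒜 j y ∈ maxIdeal 𝒜 ^ a := by
  classical
  induction y using DirectSum.Decomposition.inductionOn 𝒜 with
  | zero => simp
  | @homogeneous n y =>
    rcases lt_or_ge n a with h | h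
    · rw [Finset.sum_eq_single_of_mem ⟨n, h⟩ (Finset.mem_univ _), proj_of_mem y.2, if_pos rfl,
        sub_self]
      · exact zero_mem _
      · intro j _ hj
        rw [proj_of_mem y.2, if_neg fun h => hj (Fin.ext h.symm)]
    · rw [Finset.sum_eq_zero, sub_zero]
      · exact hA.mem_pow_of_mem h y.2
      · intro j _
        rw [proj_of_mem y.2, if_neg]
        have := j.2
        omega
  | add y z hy hz =>
    simp only [map_add, Finset.sum_add_distrib]
    rw [add_sub_add_comm]
    exact add_mem hy hz

/-- The constant coefficient `A → A_0 = k`. -/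
theorem IsStandardGraded.exists_constCoeff (hA : IsStandardGraded 𝒜) :
    ∃ σ : A →ₗ[k] k, ∀ y, algebraMap k A (σ y) = GradedAlgebra.proj 𝒜 0 y := by
  have := hA.nontrivial
  obtain ⟨f, hf, -⟩ := Submodule.exists_le_ker_of_notMem (p := (⊥ : Submodule k A))
    (v := (1 : A)) (by simp)
  -- On $A_0=k\cdot 1$ the functional $f/f(1)$ inverts the structure map.
  refine ⟨(f 1)⁻¹ • f ∘ₗ GradedAlgebra.proj 𝒜 0, fun y => ?_⟩
  obtain ⟨r, hr⟩ := hA.exists_algebraMap_eq (proj_mem 0 y)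
  rw [← hr]
  congr 1
  rw [LinearMap.smul_apply, LinearMap.comp_apply, ← hr, Algebra.algebraMap_eq_smul_one r,
    map_smul f, smul_eq_mul, smul_eq_mul, mul_left_comm, inv_mul_cancel₀ hf, mul_one]

end PowersOfMaxIdeal

/-! ### Exactness of the columns -/

section Terms

variable {k : Type*} {A : Type*} [Field k] [Ring A] [Algebra k A] (𝒜 : ℕ → Submodule k A)

@[simp] theorem multMap_tmul {W : Type*} [AddCommGroup W] [Module k W] (e : W →ₗ[k] A) (y : A)
    (c : CoDual 𝒜 0) (w : W) : multMap 𝒜 e (y ⊗ₜ (c ⊗ₜ w)) = c (dualOne 𝒜) • (y * e w) := by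
  simp [multMap, mulAct]

/-- Two `A`-linear maps on `A ⊗ C ⊗ W` that agree on all `1 ⊗ c ⊗ w` are equal. -/
theorem termHom_ext {C W Q : Type*} [AddCommGroup C] [Module k C] [AddCommGroup W] [Module k W]
    [AddCommMonoid Q] [Module A Q] {f g : A ⊗[k] (C ⊗[k] W) →ₗ[A] Q}
    (h : ∀ c w, f (1 ⊗ₜ (c ⊗ₜ w)) = g (1 ⊗ₜ (c ⊗ₜ w))) : f = g := by
  ext t
  induction t with
  | zero => simp
  | tmul y s =>
    induction s with
    | zero => simp
    | add a b ha hb => rw [TensorProduct.tmul_add, map_add, map_add, ha, hb]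
    | tmul c w =>
      have : y ⊗ₜ[k] (c ⊗ₜ[k] w) = y • ((1 : A) ⊗ₜ[k] (c ⊗ₜ[k] w)) := by
        rw [TensorProduct.smul_tmul', smul_eq_mul, mul_one]
      rw [this, map_smul, map_smul, h]
  | add a b ha hb => rw [map_add, map_add, ha, hb]

variable {ι : Type*} [Fintype ι] (x : Module.Basis ι k (𝒜 1))

@[simp] theorem dVert_tmul (n : ℕ) {W : Type*} [AddCommGroup W] [Module k W] (y : A)
    (c : CoDual 𝒜 (n + 1)) (w : W) : dVert 𝒜 x n W (y ⊗ₜ (c ⊗ₜ w)) =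
      ∑ l, (y * x l) ⊗ₜ (codualRight 𝒜 n (x.coord l) c ⊗ₜ w) := by
  simp [dVert]

@[simp] theorem dHor_tmul (n : ℕ) {W W' : Type*} [AddCommGroup W] [Module k W] [AddCommGroup W']
    [Module k W'] (μ : 𝒜 1 → W →ₗ[k] W') (y : A) (c : CoDual 𝒜 (n + 1)) (w : W) :
    dHor 𝒜 x n μ (y ⊗ₜ (c ⊗ₜ w)) =
      ∑ l, y ⊗ₜ (codualLeft 𝒜 n (x.coord l) c ⊗ₜ μ (x l) w) := by
  simp [dHor]

theorem dVert_comp_assoc (n : ℕ) (W : Type*) [AddCommGroup W] [Module k W] :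
    (dVert 𝒜 x n W).restrictScalars k ∘ₗ (TensorProduct.assoc k A (CoDual 𝒜 (n + 1)) W).toLinearMap =
      (TensorProduct.assoc k A (CoDual 𝒜 n) W).toLinearMap ∘ₗ
        ((koszulDiff 𝒜 x n).restrictScalars k).rTensor W := by
  apply TensorProduct.ext_threefold
  intro y c w
  simp [TensorProduct.sum_tmul]

variable [GradedAlgebra 𝒜]

/-- Up to reassociation the column is the Koszul complex tensored with $W$, and $W$ is flat over the
field $k$. -/
theorem dVert_exact (hA : IsStandardGraded 𝒜) (hK : IsKoszul 𝒜) (n : ℕ) (W : Type*)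
    [AddCommGroup W] [Module k W] :
    Function.Exact (dVert 𝒜 x (n + 1) W) (dVert 𝒜 x n W) := by
  have h := Module.Flat.rTensor_exact W (f := (koszulDiff 𝒜 x (n + 1)).restrictScalars k)
    (g := (koszulDiff 𝒜 x n).restrictScalars k) (koszulDiff_exact x hA hK n)
  exact (Function.Exact.iff_of_ladder_linearEquiv (dVert_comp_assoc 𝒜 x (n + 1) W)
    (dVert_comp_assoc 𝒜 x n W)).mpr h

/-- Exactness at `A ⊗ (A^!)^*_0 ⊗ A_m`: the kernel of the augmentation to `A_m`, the component
of degree `m` of the multiplication map. -/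
theorem mem_range_dVert_zero (hA : IsStandardGraded 𝒜) (hK : IsKoszul 𝒜) {m : ℕ}
    (z : BiTerm 𝒜 0 m) (hz : GradedAlgebra.proj 𝒜 m (multMap 𝒜 (𝒜 m).subtype z) = 0) :
    z ∈ Set.range (dVert 𝒜 x 0 (𝒜 m)) := by
  obtain ⟨σ, hσ⟩ := hA.exists_constCoeff
  have hinj := hA.algebraMap_injective
  let u : A ⊗[k] CoDual 𝒜 0 →ₗ[k] A := (TensorProduct.rid k A).toLinearMap ∘ₗ
    (Module.Dual.eval k _ (dualOne 𝒜)).lTensor A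
  have hu : ∀ t, koszulAug 𝒜 t = Submodule.Quotient.mk (u t) := by
    intro t
    induction t with
    | zero => rw [map_zero, map_zero, Submodule.Quotient.mk_zero]
    | add a b ha hb => rw [map_add, map_add, ha, hb]; rfl
    | tmul y c => rw [koszulAug_tmul]; simp [u]
  -- The constant coefficient replaces $A/\mathfrak m$ by $k$, so tensoring with $A_m$ gives an
  -- augmentation with values in $k\otimes A_m=A_m$.
  have hex : Function.Exact ((koszulDiff 𝒜 x 0).restrictScalars k) (σ ∘ₗ u) := by
    intro t
    rw [LinearMap.coe_restrictScalars, ← koszulAug_exact x hA hK t, hu,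
      Submodule.Quotient.mk_eq_zero, mem_maxIdeal_iff, ← hσ, map_eq_zero_iff _ hinj]
    rfl
  have h := Module.Flat.rTensor_exact (𝒜 m) hex
  obtain ⟨t, rfl⟩ := (TensorProduct.assoc k A (CoDual 𝒜 0) (𝒜 m)).surjective z
  have key : ∀ t, GradedAlgebra.proj 𝒜 m (multMap 𝒜 (𝒜 m).subtype
      (TensorProduct.assoc k A (CoDual 𝒜 0) (𝒜 m) t)) =
        (TensorProduct.lid k (𝒜 m) ((σ ∘ₗ u).rTensor (𝒜 m) t) : A) := by
    have : GradedAlgebra.proj 𝒜 m ∘ₗ (multMap 𝒜 (𝒜 m).subtype).restrictScalars k ∘ₗ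
        (TensorProduct.assoc k A (CoDual 𝒜 0) (𝒜 m)).toLinearMap =
        (𝒜 m).subtype ∘ₗ (TensorProduct.lid k (𝒜 m)).toLinearMap ∘ₗ (σ ∘ₗ u).rTensor (𝒜 m) := by
      apply TensorProduct.ext_threefold
      intro y c b
      -- As `b` has degree $m$, only the constant term of `y` contributes in degree $m$.
      have hb : GradedAlgebra.proj 𝒜 m (y * b) = σ y • (b : A) := by
        rw [Algebra.smul_def, hσ]
        induction y using DirectSum.Decomposition.inductionOn 𝒜 with
        | zero => simp
        | @homogeneous i y =>
          rw [proj_of_mem (SetLike.GradedMul.mul_mem y.2 b.2), proj_of_mem y.2]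
          by_cases hi : i = 0
          · rw [if_pos hi, if_pos (by omega)]
          · rw [if_neg hi, if_neg (by omega), zero_mul]
        | add y z hy hz => rw [add_mul, map_add, map_add, add_mul, hy, hz]
      simp only [LinearMap.comp_apply, LinearEquiv.coe_coe, TensorProduct.assoc_tmul,
        LinearMap.coe_restrictScalars, multMap_tmul, map_smul, Submodule.subtype_apply, hb]
      simp [u, mul_smul]
    exact fun t => LinearMap.congr_fun this t
  rw [key, ZeroMemClass.coe_eq_zero, EmbeddingLike.map_eq_zero_iff] at hz
  obtain ⟨s, rfl⟩ := (h t).mp hz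
  exact ⟨_, LinearMap.congr_fun (dVert_comp_assoc 𝒜 x 0 (𝒜 m)) s⟩

end Terms

/-! ### The complex $\mathbb F^A$ -/

section BimoduleComplex

variable {k : Type*} {A : Type*} [Field k] [Ring A] [Algebra k A] (𝒜 : ℕ → Submodule k A)
  {ι : Type*} [Fintype ι] (x : Module.Basis ι k (𝒜 1))

theorem codualRight_codualLeft (n : ℕ) (f g : Module.Dual k (𝒜 1)) (c : CoDual 𝒜 (n + 2)) :
    codualRight 𝒜 n f (codualLeft 𝒜 (n + 1) g c) =
      codualLeft 𝒜 n g (codualRight 𝒜 (n + 1) f c) := by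
  ext y
  simp only [codualRight_apply, codualLeft_apply]
  congr 1
  ext
  simp [mul_assoc]

theorem dVert_dVert (n : ℕ) {W : Type*} [AddCommGroup W] [Module k W] (c : CoDual 𝒜 (n + 2))
    (w : W) : dVert 𝒜 x n W (dVert 𝒜 x (n + 1) W (1 ⊗ₜ (c ⊗ₜ w))) = 0 := by
  have := sum_mul_tmul_eq_zero 𝒜 x (C := CoDual 𝒜 n ⊗[k] W) ((TensorProduct.mk k (CoDual 𝒜 n) W).flip w ∘ₗ codualRight₂ 𝒜 n c)
    fun q hq => by rw [LinearMap.comp_apply, codualRight₂_eq_zero 𝒜 n c hq, map_zero]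
  simpa using this

theorem dHor_dHor (n : ℕ) (c : CoDual 𝒜 (n + 2)) (b : A) :
    dHor 𝒜 x n (fun v => LinearMap.mulLeft k (v : A))
      (dHor 𝒜 x (n + 1) (fun v => LinearMap.mulLeft k (v : A)) (1 ⊗ₜ (c ⊗ₜ b))) = 0 := by
  have h := sum_mul_tmul_eq_zero 𝒜 x (codualLeft₂ 𝒜 n c)
    fun q hq => codualLeft₂_eq_zero 𝒜 n c hq
  have h' := congrArg (fun z => (1 : A) ⊗ₜ[k] (LinearMap.mulRight k b).lTensor _
    (TensorProduct.comm k _ _ z)) h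
  simp only [map_sum, TensorProduct.comm_tmul, codualLeft₂_tmul, LinearMap.lTensor_tmul,
    LinearMap.mulRight_apply, map_zero, TensorProduct.tmul_zero, TensorProduct.tmul_sum] at h'
  simp only [dHor_tmul, map_sum, LinearMap.mulLeft_apply, ← mul_assoc]
  rwa [Finset.sum_comm]

theorem dVert_dHor (n : ℕ) (c : CoDual 𝒜 (n + 2)) (b : A) :
    dVert 𝒜 x n A (dHor 𝒜 x (n + 1) (fun v => LinearMap.mulLeft k (v : A)) (1 ⊗ₜ (c ⊗ₜ b))) =
      dHor 𝒜 x n (fun v => LinearMap.mulLeft k (v : A)) (dVert 𝒜 x (n + 1) A (1 ⊗ₜ (c ⊗ₜ b))) := by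
  simp only [dHor_tmul, dVert_tmul, map_sum, codualRight_codualLeft]
  exact Finset.sum_comm

/-- Both squares vanish, and the mixed terms $\partial'\partial''=\partial''\partial'$ carry the
opposite signs $(-1)^{n+2}$ and $(-1)^{n+1}$. -/
theorem FDiff_FDiff (n : ℕ) (z : FTerm 𝒜 (n + 2)) :
    FDiff 𝒜 x n (FDiff 𝒜 x (n + 1) z) = 0 := by
  suffices h : FDiff 𝒜 x n ∘ₗ FDiff 𝒜 x (n + 1) = 0 from LinearMap.congr_fun h z
  apply termHom_ext
  intro c b
  simp only [FDiff, LinearMap.comp_apply, LinearMap.add_apply, LinearMap.smul_apply, map_add,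
    map_zsmul, dVert_dVert, dHor_dHor, dVert_dHor, LinearMap.zero_apply, smul_zero, add_zero,
    zero_add]
  rw [← add_smul, pow_succ _ (n + 1)]
  simp

/-- Both actions of $f$ on $c$ have the value $c(f)$ at $1$, so on $1\otimes c\otimes b$ the two
parts of the differential give $\sum c(x_l^*)x_lb$ with opposite signs. -/
theorem FAug_FDiff (z : FTerm 𝒜 1) : FAug 𝒜 (FDiff 𝒜 x 0 z) = 0 := by
  suffices h : FAug 𝒜 ∘ₗ FDiff 𝒜 x 0 = 0 from LinearMap.congr_fun h z
  apply termHom_ext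
  intro c b
  have h : ∀ f, codualLeft 𝒜 0 f c (dualOne 𝒜) = codualRight 𝒜 0 f c (dualOne 𝒜) := by
    intro f
    rw [codualRight_apply, codualLeft_apply]
    congr 1
    ext
    simp [dualOne]
  simp [FAug, FDiff, h]

end BimoduleComplex

/-! ### The truncation map and its kernel $F_n\mathfrak m^a$ -/

section Quotient

variable {k : Type*} {A : Type*} [Field k] [Ring A] [Algebra k A] (𝒜 : ℕ → Submodule k A)
  [GradedAlgebra 𝒜]

/-- The projection `A → A_j`. -/
def projTo (j : ℕ) : A →ₗ[k] 𝒜 j := (GradedAlgebra.proj 𝒜 j).codRestrict (𝒜 j) (proj_mem j)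

@[simp] theorem coe_projTo (j : ℕ) (b : A) : (projTo 𝒜 j b : A) = GradedAlgebra.proj 𝒜 j b := rfl

theorem projTo_coe (j : ℕ) (b : 𝒜 j) : projTo 𝒜 j b = b := by
  ext
  rw [coe_projTo, proj_of_mem b.2, if_pos rfl]

theorem projTo_of_ne {i j : ℕ} (h : i ≠ j) (b : 𝒜 i) : projTo 𝒜 j b = 0 := by
  ext
  rw [coe_projTo, proj_of_mem b.2, if_neg h, Submodule.coe_zero]

/-- The truncation `A ⊗ (A^!)^*_n ⊗ A → A ⊗ (A^!)^*_n ⊗ A_{≤ a-1}`. -/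
def truncMap (a n : ℕ) : FTerm 𝒜 n →ₗ[A] XTerm 𝒜 a n :=
  ∑ j : Fin a, DirectSum.lof A (Fin a) (fun j => BiTerm 𝒜 n j) j ∘ₗ
    TensorProduct.AlgebraTensorModule.map LinearMap.id
      (TensorProduct.map LinearMap.id (projTo 𝒜 j))

theorem truncMap_tmul (a n : ℕ) (y : A) (c : CoDual 𝒜 n) (b : A) :
    truncMap 𝒜 a n (y ⊗ₜ (c ⊗ₜ b)) = ∑ j : Fin a,
      DirectSum.lof A (Fin a) (fun j => BiTerm 𝒜 n j) j (y ⊗ₜ (c ⊗ₜ projTo 𝒜 j b)) := by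
  simp [truncMap]

theorem truncMap_coe (a n : ℕ) (y : A) (c : CoDual 𝒜 n) {i : ℕ} (b : 𝒜 i) :
    truncMap 𝒜 a n (y ⊗ₜ (c ⊗ₜ (b : A))) = if h : i < a then
      DirectSum.lof A (Fin a) (fun j => BiTerm 𝒜 n j) ⟨i, h⟩ (y ⊗ₜ (c ⊗ₜ b)) else 0 := by
  rw [truncMap_tmul]
  split_ifs with h
  · rw [Finset.sum_eq_single_of_mem ⟨i, h⟩ (Finset.mem_univ _)]
    · rw [projTo_coe]
    · intro j _ hj
      rw [projTo_of_ne 𝒜 fun h => hj (Fin.ext h.symm), TensorProduct.tmul_zero,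
        TensorProduct.tmul_zero, map_zero]
  · refine Finset.sum_eq_zero fun j _ => ?_
    rw [projTo_of_ne 𝒜 (by have := j.2; omega), TensorProduct.tmul_zero,
      TensorProduct.tmul_zero, map_zero]

omit [GradedAlgebra 𝒜] in
@[simp] theorem FMulRight_tmul (n : ℕ) (y : A) (c : CoDual 𝒜 n) (b b' : A) :
    FMulRight 𝒜 n b' (y ⊗ₜ (c ⊗ₜ b)) = y ⊗ₜ (c ⊗ₜ (b * b')) := by
  simp [FMulRight]

theorem FMulIdeal_le_ker_truncMap (a n : ℕ) :
    FMulIdeal 𝒜 n (maxIdeal 𝒜 ^ a) ≤ LinearMap.ker (truncMap 𝒜 a n) := by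
  rw [FMulIdeal, Submodule.span_le]
  rintro _ ⟨w, b, hb, rfl⟩
  change (truncMap 𝒜 a n ∘ₗ FMulRight 𝒜 n b) w = (0 : _ →ₗ[A] _) w
  congr 1
  apply termHom_ext
  intro c b'
  rw [LinearMap.comp_apply, FMulRight_tmul, truncMap_tmul, LinearMap.zero_apply]
  refine Finset.sum_eq_zero fun j _ => ?_
  have : projTo 𝒜 j (b' * b) = 0 := by
    ext
    exact proj_eq_zero_of_mem_pow (Ideal.mul_mem_left _ b' hb) j.2
  rw [this, TensorProduct.tmul_zero, TensorProduct.tmul_zero, map_zero]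

theorem sub_mem_of_forall_tmul {C W : Type*} [AddCommGroup C] [Module k C] [AddCommGroup W]
    [Module k W] (f : A ⊗[k] (C ⊗[k] W) →ₗ[A] A ⊗[k] (C ⊗[k] W))
    (I : Submodule A (A ⊗[k] (C ⊗[k] W)))
    (h : ∀ c w, 1 ⊗ₜ (c ⊗ₜ w) - f (1 ⊗ₜ (c ⊗ₜ w)) ∈ I) (z : A ⊗[k] (C ⊗[k] W)) : z - f z ∈ I := by
  have key : I.mkQ = I.mkQ ∘ₗ f :=
    termHom_ext fun c w => (Submodule.Quotient.eq I).mpr (h c w)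
  exact (Submodule.Quotient.eq I).mp (LinearMap.congr_fun key z)

/-- The inclusion `A ⊗ (A^!)^*_n ⊗ A_{≤ a-1} → A ⊗ (A^!)^*_n ⊗ A`. -/
def inclMap (a n : ℕ) : XTerm 𝒜 a n →ₗ[A] FTerm 𝒜 n :=
  DirectSum.toModule A (Fin a) _ fun j =>
    TensorProduct.AlgebraTensorModule.map LinearMap.id
      (TensorProduct.map LinearMap.id (𝒜 j).subtype)

omit [GradedAlgebra 𝒜] in
theorem inclMap_lof (a n : ℕ) (j : Fin a) (y : A) (c : CoDual 𝒜 n) (b : 𝒜 j) :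
    inclMap 𝒜 a n (DirectSum.lof A (Fin a) (fun j => BiTerm 𝒜 n j) j (y ⊗ₜ (c ⊗ₜ b))) =
      y ⊗ₜ (c ⊗ₜ (b : A)) := by
  rw [inclMap, DirectSum.toModule_lof]
  rfl

theorem truncMap_inclMap (a n : ℕ) (z : XTerm 𝒜 a n) :
    truncMap 𝒜 a n (inclMap 𝒜 a n z) = z := by
  suffices h : truncMap 𝒜 a n ∘ₗ inclMap 𝒜 a n = LinearMap.id from LinearMap.congr_fun h z
  refine DirectSum.linearMap_ext A fun j => termHom_ext fun c b => ?_
  rw [LinearMap.comp_apply, LinearMap.comp_apply, inclMap_lof, truncMap_coe, dif_pos j.2]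
  rfl

theorem inclMap_truncMap_tmul (a n : ℕ) (y : A) (c : CoDual 𝒜 n) (b : A) :
    inclMap 𝒜 a n (truncMap 𝒜 a n (y ⊗ₜ (c ⊗ₜ b))) =
      y ⊗ₜ (c ⊗ₜ ∑ j : Fin a, GradedAlgebra.proj 𝒜 j b) := by
  rw [truncMap_tmul]
  rw [map_sum (inclMap 𝒜 a n)]
  simp only [TensorProduct.tmul_sum]
  exact Finset.sum_congr rfl fun j _ => inclMap_lof 𝒜 a n j y c (projTo 𝒜 j b)

theorem sub_inclMap_truncMap_tmul_mem (hA : IsStandardGraded 𝒜) (a n : ℕ) (c : CoDual 𝒜 n)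
    (b : A) : 1 ⊗ₜ (c ⊗ₜ b) - inclMap 𝒜 a n (truncMap 𝒜 a n (1 ⊗ₜ (c ⊗ₜ b))) ∈
      FMulIdeal 𝒜 n (maxIdeal 𝒜 ^ a) := by
  rw [inclMap_truncMap_tmul]
  -- The difference is $1\otimes c\otimes1$ multiplied on the right by the tail of `b` in degrees
  -- $\ge a$.
  refine Submodule.subset_span ⟨1 ⊗ₜ (c ⊗ₜ 1), _, sum_proj_sub_mem hA a b, ?_⟩
  rw [FMulRight_tmul, one_mul, sub_eq_iff_eq_add, ← TensorProduct.tmul_add,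
    ← TensorProduct.tmul_add, sub_add_cancel]

theorem sub_inclMap_truncMap_mem (hA : IsStandardGraded 𝒜) (a n : ℕ) (z : FTerm 𝒜 n) :
    z - inclMap 𝒜 a n (truncMap 𝒜 a n z) ∈ FMulIdeal 𝒜 n (maxIdeal 𝒜 ^ a) :=
  sub_mem_of_forall_tmul (inclMap 𝒜 a n ∘ₗ truncMap 𝒜 a n) _
    (sub_inclMap_truncMap_tmul_mem 𝒜 hA a n) z

/-- `inclMap` is a section of `truncMap`, and it recovers each element up to $F_n\mathfrak m^a$. -/
theorem FMulIdeal_eq_ker_truncMap (hA : IsStandardGraded 𝒜) (a n : ℕ) :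
    FMulIdeal 𝒜 n (maxIdeal 𝒜 ^ a) = LinearMap.ker (truncMap 𝒜 a n) := by
  refine le_antisymm (FMulIdeal_le_ker_truncMap 𝒜 a n) fun z hz => ?_
  have h := sub_inclMap_truncMap_mem 𝒜 hA a n z
  rwa [LinearMap.mem_ker.mp hz, map_zero, sub_zero] at h

theorem truncMap_surjective (a n : ℕ) : Function.Surjective (truncMap 𝒜 a n) :=
  fun z => ⟨_, truncMap_inclMap 𝒜 a n z⟩


end Quotient

section

variable {R F X : Type*} [Ring R] [AddCommGroup F] [Module R F] [AddCommGroup X] [Module R X]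

/-- The first isomorphism theorem for a surjective map with a given kernel. -/
theorem exists_quotEquiv_of_surjective (f : F →ₗ[R] X) (hf : Function.Surjective f)
    (I : Submodule R F) (h : I = LinearMap.ker f) :
    ∃ e : (F ⧸ I) ≃ₗ[R] X, ∀ z, e (Submodule.Quotient.mk z) = f z :=
  ⟨(Submodule.quotEquivOfEq _ _ h).trans (f.quotKerEquivOfSurjective hf), fun _ => rfl⟩

end

/-! ### Truncation is a map of augmented complexes -/

section Truncation

variable {k : Type*} {A : Type*} [Field k] [Ring A] [Algebra k A] (𝒜 : ℕ → Submodule k A)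
  [GradedAlgebra 𝒜]

theorem exists_truncEquiv (hA : IsStandardGraded 𝒜) (a n : ℕ) :
    ∃ e : (FTerm 𝒜 n ⧸ FMulIdeal 𝒜 n (maxIdeal 𝒜 ^ a)) ≃ₗ[A] XTerm 𝒜 a n,
      ∀ z, e (Submodule.Quotient.mk z) = truncMap 𝒜 a n z :=
  @exists_quotEquiv_of_surjective A (FTerm 𝒜 n) (XTerm 𝒜 a n) _ _ _ _ _ (truncMap 𝒜 a n)
    (truncMap_surjective 𝒜 a n) _ (FMulIdeal_eq_ker_truncMap 𝒜 hA a n)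

/-- Two `A`-linear maps on `A ⊗ C ⊗ A` that agree on `1 ⊗ c ⊗ b` for homogeneous `b` are equal. -/
theorem termHom_ext_homogeneous {C Q : Type*} [AddCommGroup C] [Module k C]
    [AddCommMonoid Q] [Module A Q] {f g : A ⊗[k] (C ⊗[k] A) →ₗ[A] Q}
    (h : ∀ c i, ∀ b : 𝒜 i, f (1 ⊗ₜ (c ⊗ₜ (b : A))) = g (1 ⊗ₜ (c ⊗ₜ (b : A)))) : f = g := by
  apply termHom_ext
  intro c b
  induction b using DirectSum.Decomposition.inductionOn 𝒜 with
  | zero => simp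
  | homogeneous b => exact h c _ b
  | add a b ha hb => simp only [TensorProduct.tmul_add, map_add, ha, hb]

variable {ι : Type*} [Fintype ι] (x : Module.Basis ι k (𝒜 1))

theorem XDiff_lof (a n : ℕ) (j : Fin a) (z : BiTerm 𝒜 (n + 1) j) :
    XDiff 𝒜 x a n (DirectSum.lof A (Fin a) (fun j => BiTerm 𝒜 (n + 1) j) j z) =
      DirectSum.lof A (Fin a) (fun j => BiTerm 𝒜 n j) j (dVert 𝒜 x n (𝒜 j) z) +
      if h : (j : ℕ) + 1 < a then (-1 : ℤ) ^ (n + 1) •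
        DirectSum.lof A (Fin a) (fun j => BiTerm 𝒜 n j) ⟨j + 1, h⟩
          (dHor 𝒜 x n (mulComponent 𝒜 j) z)
      else 0 := by
  rw [XDiff, DirectSum.toModule_lof]
  split_ifs <;> simp

/-- The critical case is `b` of degree $a-1$: then $x_lb$ has degree $a$ and is truncated away,
matching the omitted component of the differential. -/
theorem XDiff_truncMap (a n : ℕ) (z : FTerm 𝒜 (n + 1)) :
    XDiff 𝒜 x a n (truncMap 𝒜 a (n + 1) z) = truncMap 𝒜 a n (FDiff 𝒜 x n z) := by
  suffices h : XDiff 𝒜 x a n ∘ₗ truncMap 𝒜 a (n + 1) = truncMap 𝒜 a n ∘ₗ FDiff 𝒜 x n from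
    LinearMap.congr_fun h z
  refine termHom_ext_homogeneous 𝒜 fun c i b => ?_
  have hb : ∀ l, (x l : A) * b = (mulComponent 𝒜 i (x l) b : A) := fun l => rfl
  simp only [LinearMap.comp_apply, FDiff, LinearMap.add_apply, LinearMap.smul_apply, map_add,
    map_zsmul, dVert_tmul, dHor_tmul, map_sum, LinearMap.mulLeft_apply, hb, truncMap_coe]
  by_cases hi : i < a
  · simp only [dif_pos hi, XDiff_lof]
    by_cases hi' : i + 1 < a
    · simp only [dif_pos hi']
      simp
    · simp only [dif_neg hi']
      simp
  · have hi' : ¬ i + 1 < a := by omega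
    simp only [dif_neg hi, dif_neg hi']
    simp

theorem XAug_lof (a : ℕ) (j : Fin a) (z : BiTerm 𝒜 0 j) :
    XAug 𝒜 a (DirectSum.lof A (Fin a) (fun j => BiTerm 𝒜 0 j) j z) =
      Submodule.Quotient.mk (multMap 𝒜 (𝒜 j).subtype z) := by
  rw [XAug, DirectSum.toModule_lof]
  rfl

theorem XAug_truncMap (hA : IsStandardGraded 𝒜) (a : ℕ) (z : FTerm 𝒜 0) :
    XAug 𝒜 a (truncMap 𝒜 a 0 z) = Submodule.Quotient.mk (FAug 𝒜 z) := by
  suffices h : XAug 𝒜 a ∘ₗ truncMap 𝒜 a 0 = (maxIdeal 𝒜 ^ a).mkQ ∘ₗ FAug 𝒜 from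
    LinearMap.congr_fun h z
  refine termHom_ext_homogeneous 𝒜 fun c i b => ?_
  simp only [LinearMap.comp_apply, truncMap_coe, FAug, multMap_tmul, one_mul, LinearMap.id_apply,
    Submodule.mkQ_apply]
  split_ifs with h
  · rw [XAug_lof, multMap_tmul, one_mul, Submodule.subtype_apply]
  · rw [map_zero, eq_comm, Submodule.Quotient.mk_eq_zero]
    exact hA.mem_pow_of_mem (not_lt.mp h) ((𝒜 i).smul_mem _ b.2)

end Truncation

universe u v w

/-! ### Triangular maps between finite direct sums -/

section FilteredSums

variable {R : Type*} [Ring R] {a : ℕ} {B₀ B₁ B₂ : Fin a → Type*}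
  [∀ j, AddCommGroup (B₀ j)] [∀ j, Module R (B₀ j)] [∀ j, AddCommGroup (B₁ j)]
  [∀ j, Module R (B₁ j)] [∀ j, AddCommGroup (B₂ j)] [∀ j, Module R (B₂ j)]

theorem sum_lof (z : ⨁ j, B₁ j) : ∑ j, DirectSum.lof R (Fin a) B₁ j (z j) = z :=
  DirectSum.sum_univ_of z

theorem lof_apply_of_ne {i j : Fin a} (h : i ≠ j) (u : B₁ i) :
    DirectSum.lof R (Fin a) B₁ i u j = 0 :=
  DirectSum.of_eq_of_ne _ _ _ h.symm

/-- A map of direct sums that is triangular has the expected leading term. -/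
theorem apply_of_triangular (D : (⨁ j, B₁ j) →ₗ[R] ⨁ j, B₀ j) (v : ∀ j, B₁ j →ₗ[R] B₀ j)
    (h : ∀ i j u, j < i → D (DirectSum.lof R (Fin a) B₁ i u) j = 0)
    (h' : ∀ j u, D (DirectSum.lof R (Fin a) B₁ j u) j = v j u)
    (z : ⨁ j, B₁ j) (j : Fin a) (hz : ∀ i < j, z i = 0) : D z j = v j (z j) := by
  conv_lhs => rw [← sum_lof (R := R) z, map_sum, DirectSum.sum_apply]
  rw [Finset.sum_eq_single_of_mem j (Finset.mem_univ _), h']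
  intro i _ hij
  rcases lt_or_gt_of_ne hij with hlt | hgt
  · rw [hz i hlt, map_zero, map_zero, DirectSum.zero_apply]
  · exact h i j _ hgt

/-- Exactness of a complex of finitely filtered modules follows from exactness of the leading
terms. -/
theorem mem_range_of_triangular {Q : Type*} [AddCommMonoid Q] [Module R Q]
    (D₂ : (⨁ j, B₂ j) →ₗ[R] ⨁ j, B₁ j) (D₁ : (⨁ j, B₁ j) →ₗ[R] Q) (v : ∀ j, B₂ j →ₗ[R] B₁ j)
    (h : ∀ i j u, j < i → D₂ (DirectSum.lof R (Fin a) B₂ i u) j = 0)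
    (h' : ∀ j u, D₂ (DirectSum.lof R (Fin a) B₂ j u) j = v j u)
    (hc : ∀ u, D₁ (D₂ u) = 0)
    (hex : ∀ j z, (∀ i < j, z i = 0) → D₁ z = 0 → z j ∈ Set.range (v j))
    (z : ⨁ j, B₁ j) (hz : D₁ z = 0) : z ∈ Set.range D₂ := by
  -- Here `r` counts the columns not yet cleared. Subtracting the image of a lift of the entry in
  -- column `m` clears that column, and by triangularity leaves the earlier ones zero.
  have key : ∀ r, ∀ m, m + r = a → ∀ z : ⨁ j, B₁ j, (∀ i : Fin a, (i : ℕ) < m → z i = 0) →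
      D₁ z = 0 → z ∈ LinearMap.range D₂ := by
    intro r
    induction r with
    | zero =>
      intro m hm z hz _
      have : z = 0 := by
        rw [← sum_lof (R := R) z]
        exact Finset.sum_eq_zero fun i _ => by rw [hz i (by omega), map_zero]
      rw [this]
      exact zero_mem _
    | succ r ih =>
      intro m hm z hz hz'
      let j : Fin a := ⟨m, by omega⟩
      obtain ⟨u, hu⟩ := hex j z (fun i hi => hz i hi) hz'
      have := ih (m + 1) (by omega) (z - D₂ (DirectSum.lof R (Fin a) B₂ j u)) (fun i hi => by
        rw [DirectSum.sub_apply]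
        rcases Nat.lt_succ_iff_lt_or_eq.mp hi with hlt | heq
        · rw [hz i hlt, h j i u hlt, sub_zero]
        · have : i = j := Fin.ext heq
          rw [this, h', hu, sub_self]) (by
          rw [← hz', ← sub_add_cancel z (D₂ (DirectSum.lof R (Fin a) B₂ j u)), map_add, hc,
            add_zero, sub_add_cancel])
      have h2 := add_mem this (LinearMap.mem_range_self D₂ (DirectSum.lof R (Fin a) B₂ j u))
      rwa [sub_add_cancel] at h2
  exact key a 0 (by omega) z (fun i hi => by omega) hz

end FilteredSums

/-! ### Homogeneous bases and internal gradings -/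

section Bases

theorem exists_basis_directSum {R : Type*} [Ring R] [Nontrivial R] {J : Type u} [DecidableEq J]
    {B : J → Type v} [∀ j, AddCommGroup (B j)] [∀ j, Module R (B j)] {η : J → Type*}
    (b : ∀ j, Module.Basis (η j) R (B j)) :
    ∃ (S : Type (max u v)) (β : Module.Basis S R (⨁ j, B j)),
      ∀ s, ∃ j t, β s = DirectSum.lof R J B j (b j t) := by
  let β₀ : Module.Basis (Σ j, η j) R (⨁ j, B j) := DFinsupp.basis b
  have h : ∀ j t, β₀ ⟨j, t⟩ = DirectSum.lof R J B j (b j t) := by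
    intro j t
    rw [Module.Basis.apply_eq_iff]
    change (sigmaFinsuppLequivDFinsupp R).symm (DFinsupp.mapRange.linearEquiv
      (fun i => (b i).repr) (DFinsupp.single j (b j t))) = _
    rw [LinearEquiv.symm_apply_eq]
    simp
  -- Indexing the basis by its own range puts the index type in the universe of the module, as
  -- `IsGradedFree` requires.
  refine ⟨Set.range β₀, β₀.reindexRange, ?_⟩
  rintro ⟨_, ⟨j, t⟩, rfl⟩
  exact ⟨j, t, (β₀.reindexRange_apply _).trans (h j t)⟩

end Bases

section Internal

variable {k M : Type*} [Field k] [AddCommGroup M] [Module k M]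

theorem isInternal_of_projections (ℳ : ℕ → Submodule k M) (π : ℕ → M →ₗ[k] M)
    (h : ∀ N z, z ∈ ℳ N → ∀ N', π N' z = if N = N' then z else 0) (htop : ⨆ N, ℳ N = ⊤) :
    DirectSum.IsInternal ℳ := by
  have key : ∀ N (z : ⨁ N, ℳ N), π N (DirectSum.coeLinearMap ℳ z) = z N := by
    intro N z
    induction z using DirectSum.induction_on with
    | zero => simp
    | of i y =>
      have : DirectSum.coeLinearMap ℳ (DirectSum.of (fun i => ℳ i) i y) = y :=
        DirectSum.coeLinearMap_lof ℳ i y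
      rw [this, h i y y.2]
      split_ifs with hi
      · subst hi
        rw [DirectSum.of_eq_same]
      · rw [DirectSum.of_eq_of_ne _ _ _ (Ne.symm hi), Submodule.coe_zero]
    | add a b ha hb => rw [map_add, map_add, ha, hb, DirectSum.add_apply, Submodule.coe_add]
  constructor
  · intro z w hzw
    have hzw : DirectSum.coeLinearMap ℳ z = DirectSum.coeLinearMap ℳ w := hzw
    refine DFinsupp.ext fun N => Subtype.ext ?_
    rw [← key N z, ← key N w, hzw]
  · have : LinearMap.range (DirectSum.coeLinearMap ℳ) = ⊤ := by
      rw [DirectSum.range_coeLinearMap, htop]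
    exact LinearMap.range_eq_top.mp this

end Internal

/-! ### $A\otimes C\otimes A_{\le a-1}$ is graded free -/

section SumsOfTerms

variable {k : Type u} {A : Type v} [Field k] [Ring A] [Algebra k A] (𝒜 : ℕ → Submodule k A)
  {a : ℕ} {C : Type w} [AddCommGroup C] [Module k C]

/-- The grading of `A ⊗ C ⊗ A_{≤ a-1}` for which `C` has degree `n`. -/
def sumGrading (C : Type*) [AddCommGroup C] [Module k C] (a n N : ℕ) :
    Submodule k (⨁ j : Fin a, A ⊗[k] (C ⊗[k] 𝒜 j)) :=
  Submodule.span k {z | ∃ (j : Fin a) (p : ℕ) (y : 𝒜 p) (c : C) (b : 𝒜 j),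
    p + n + j = N ∧
      z = DirectSum.lof A (Fin a) (fun j : Fin a => A ⊗[k] (C ⊗[k] 𝒜 j)) j
        ((y : A) ⊗ₜ[k] (c ⊗ₜ[k] b))}

theorem lof_mem_sumGrading {n : ℕ} (j : Fin a) {p : ℕ} {y : A} (hy : y ∈ 𝒜 p) (c : C) (b : 𝒜 j)
    {N : ℕ} (hN : p + n + j = N) :
    DirectSum.lof A (Fin a) (fun j : Fin a => A ⊗[k] (C ⊗[k] 𝒜 j)) j (y ⊗ₜ[k] (c ⊗ₜ[k] b)) ∈
      sumGrading 𝒜 C a n N :=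
  Submodule.subset_span ⟨j, p, ⟨y, hy⟩, c, b, hN, rfl⟩

theorem sumGrading_smul_mem [GradedAlgebra 𝒜] (n i N : ℕ) (y : A)
    (m : ⨁ j : Fin a, A ⊗[k] (C ⊗[k] 𝒜 j)) (hy : y ∈ 𝒜 i) (hm : m ∈ sumGrading 𝒜 C a n N) :
    y • m ∈ sumGrading 𝒜 C a n (i + N) := by
  induction hm using Submodule.span_induction with
  | mem z hz =>
    obtain ⟨j, p, y', c, b, hN, rfl⟩ := hz
    rw [← map_smul, TensorProduct.smul_tmul', smul_eq_mul]
    exact lof_mem_sumGrading 𝒜 j (SetLike.GradedMul.mul_mem hy y'.2) c b (by omega)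
  | zero => rw [smul_zero]; exact zero_mem _
  | add z w _ _ hz hw => rw [smul_add]; exact add_mem hz hw
  | smul r z _ hz => rw [smul_comm]; exact Submodule.smul_mem _ r hz

theorem iSup_sumGrading [GradedAlgebra 𝒜] (n : ℕ) : ⨆ N, sumGrading 𝒜 C a n N = ⊤ := by
  rw [eq_top_iff]
  intro z _
  rw [← sum_lof (R := A) z]
  refine Submodule.sum_mem _ fun j _ => ?_
  generalize z j = t
  induction t with
  | zero => rw [map_zero]; exact zero_mem _
  | add t s ht hs => rw [map_add]; exact add_mem ht hs
  | tmul y s =>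
    induction s with
    | zero => rw [TensorProduct.tmul_zero, map_zero]; exact zero_mem _
    | add t s ht hs => rw [TensorProduct.tmul_add, map_add]; exact add_mem ht hs
    | tmul c b =>
      induction y using DirectSum.Decomposition.inductionOn 𝒜 with
      | zero => rw [TensorProduct.zero_tmul, map_zero]; exact zero_mem _
      | @homogeneous p y =>
        exact Submodule.mem_iSup_of_mem _ (lof_mem_sumGrading 𝒜 j y.2 c b rfl)
      | add y y' hy hy' => rw [TensorProduct.add_tmul, map_add]; exact add_mem hy hy'

/-- The projection of `A ⊗ C ⊗ A_{≤ a-1}` to its component of degree `N`. -/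
def sumProj (C : Type*) [AddCommGroup C] [Module k C] (a n : ℕ) [GradedAlgebra 𝒜] (N : ℕ) :
    (⨁ j : Fin a, A ⊗[k] (C ⊗[k] 𝒜 j)) →ₗ[k] ⨁ j : Fin a, A ⊗[k] (C ⊗[k] 𝒜 j) :=
  DirectSum.toModule k (Fin a) _ fun j => if n + j ≤ N then
    DirectSum.lof k (Fin a) (fun j : Fin a => A ⊗[k] (C ⊗[k] 𝒜 j)) j ∘ₗ
      (GradedAlgebra.proj 𝒜 (N - (n + j))).rTensor (C ⊗[k] 𝒜 j) else 0

theorem sumProj_of_mem [GradedAlgebra 𝒜] (n N : ℕ) (z : ⨁ j : Fin a, A ⊗[k] (C ⊗[k] 𝒜 j))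
    (hz : z ∈ sumGrading 𝒜 C a n N) (N' : ℕ) :
    sumProj 𝒜 C a n N' z = if N = N' then z else 0 := by
  induction hz using Submodule.span_induction with
  | mem z hz =>
    obtain ⟨j, p, y, c, b, hN, rfl⟩ := hz
    change sumProj 𝒜 C a n N' (DirectSum.lof k (Fin a) (fun j : Fin a => A ⊗[k] (C ⊗[k] 𝒜 j)) j
      ((y : A) ⊗ₜ[k] (c ⊗ₜ[k] b))) = _
    rw [sumProj, DirectSum.toModule_lof]
    by_cases hle : n + j ≤ N'
    · rw [if_pos hle, LinearMap.comp_apply, LinearMap.rTensor_tmul, proj_of_mem y.2]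
      by_cases h : N = N'
      · rw [if_pos h, if_pos (by omega)]
        rfl
      · rw [if_neg h, if_neg (by omega), TensorProduct.zero_tmul, map_zero]
    · rw [if_neg hle, if_neg (by omega), LinearMap.zero_apply]
  | zero => rw [map_zero, ite_self]
  | add z w _ _ hz hw =>
    rw [map_add, hz, hw]
    split_ifs
    · rfl
    · rw [add_zero]
  | smul r z _ hz =>
    rw [map_smul, hz]
    split_ifs
    · rfl
    · rw [smul_zero]

theorem lof_one_tmul_mem [GradedAlgebra 𝒜] (n : ℕ) (j : Fin a) (t : C ⊗[k] 𝒜 j) :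
    DirectSum.lof A (Fin a) (fun j : Fin a => A ⊗[k] (C ⊗[k] 𝒜 j)) j ((1 : A) ⊗ₜ[k] t) ∈
      sumGrading 𝒜 C a n (0 + n + j) := by
  induction t with
  | zero => rw [TensorProduct.tmul_zero, map_zero]; exact zero_mem _
  | add t s ht hs => rw [TensorProduct.tmul_add, map_add]; exact add_mem ht hs
  | tmul c b => exact lof_mem_sumGrading 𝒜 j SetLike.GradedOne.one_mem c b rfl

/-- All of $1\otimes C\otimes A_j$ lies in the single degree $n+j$, so any $k$-basis of $C\otimes
A_j$ gives a homogeneous $A$-basis of column $j$. -/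
theorem exists_basis_sumGrading [GradedAlgebra 𝒜] [Nontrivial A] (n : ℕ) :
    ∃ (S : Type (max v w)) (b : Module.Basis S A (⨁ j : Fin a, A ⊗[k] (C ⊗[k] 𝒜 j))),
      ∀ s, ∃ N, b s ∈ sumGrading 𝒜 C a n N := by
  obtain ⟨S, B, hB⟩ := exists_basis_directSum fun j : Fin a => Algebra.TensorProduct.basis A
    (Module.Basis.ofVectorSpace k (C ⊗[k] 𝒜 j))
  refine ⟨S, B, fun s => ?_⟩
  obtain ⟨j, t, ht⟩ := hB s
  refine ⟨0 + n + j, ?_⟩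
  rw [ht, Algebra.TensorProduct.basis_apply]
  exact lof_one_tmul_mem 𝒜 n j _

theorem isInternal_sumGrading [GradedAlgebra 𝒜] (n : ℕ) :
    DirectSum.IsInternal (M := ⨁ j : Fin a, A ⊗[k] (C ⊗[k] 𝒜 j)) (sumGrading 𝒜 C a n) :=
  @isInternal_of_projections k (⨁ j : Fin a, A ⊗[k] (C ⊗[k] 𝒜 j)) _ _ _ _ (sumProj 𝒜 C a n)
    (sumProj_of_mem 𝒜 n) (iSup_sumGrading 𝒜 n)

theorem isGradedFree_sumGrading [GradedAlgebra 𝒜] [Nontrivial A] (n : ℕ) :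
    @IsGradedFree k A _ _ _ 𝒜 (⨁ j : Fin a, A ⊗[k] (C ⊗[k] 𝒜 j)) _ _ _ _ (sumGrading 𝒜 C a n) := by
  constructor
  · exact isInternal_sumGrading 𝒜 n
  · exact sumGrading_smul_mem 𝒜 n
  · exact exists_basis_sumGrading 𝒜 n

end SumsOfTerms

/-! ### Exactness and homogeneity of $\mathbb X^A_a$ -/

section Resolution

variable {k : Type*} {A : Type*} [Field k] [Ring A] [Algebra k A] (𝒜 : ℕ → Submodule k A)
  [GradedAlgebra 𝒜] {ι : Type*} [Fintype ι] (x : Module.Basis ι k (𝒜 1))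

theorem XDiff_lof' (a n : ℕ) (j : Fin a) (z : BiTerm 𝒜 (n + 1) j) :
    XDiff 𝒜 x a n (DirectSum.lof A (Fin a) (fun j => BiTerm 𝒜 (n + 1) j) j z) =
      DirectSum.lof A (Fin a) (fun j => BiTerm 𝒜 n j) j (dVert 𝒜 x n (𝒜 j) z) +
      if h : (j : ℕ) + 1 < a then
        DirectSum.lof A (Fin a) (fun j => BiTerm 𝒜 n j) ⟨j + 1, h⟩
          (dHor 𝒜 x n (mulComponent 𝒜 j) ((-1 : A) ^ (n + 1) • z))
      else 0 := by
  rw [XDiff_lof]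
  congr 1
  split_ifs with h
  · rw [map_smul, map_smul, ← Int.cast_smul_eq_zsmul A]
    push_cast
    rfl
  · rfl

theorem XDiff_lof_apply_of_lt (a n : ℕ) (i j : Fin a) (u : BiTerm 𝒜 (n + 1) i) (h : j < i) :
    XDiff 𝒜 x a n (DirectSum.lof A (Fin a) (fun j => BiTerm 𝒜 (n + 1) j) i u) j = 0 := by
  have h' : (j : ℕ) < i := h
  rw [XDiff_lof', DirectSum.add_apply, lof_apply_of_ne (Ne.symm h.ne), zero_add]
  split_ifs with hi
  · have hne : (⟨i + 1, hi⟩ : Fin a) ≠ j := fun h => by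
      have := congrArg Fin.val h
      simp only at this
      omega
    rw [lof_apply_of_ne hne]
  · rfl

theorem XDiff_lof_apply_self (a n : ℕ) (j : Fin a) (u : BiTerm 𝒜 (n + 1) j) :
    XDiff 𝒜 x a n (DirectSum.lof A (Fin a) (fun j => BiTerm 𝒜 (n + 1) j) j u) j =
      dVert 𝒜 x n (𝒜 j) u := by
  rw [XDiff_lof', DirectSum.add_apply, DirectSum.lof_apply]
  split_ifs with hi
  · have hne : (⟨j + 1, hi⟩ : Fin a) ≠ j := fun h => by
      have := congrArg Fin.val h
      simp only at this
      omega
    rw [lof_apply_of_ne hne, add_zero]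
  · rw [DirectSum.zero_apply, add_zero]

/-- Every element lifts to $\mathbb F^A$ along the chain map `truncMap`, and there the square
vanishes. -/
theorem XDiff_XDiff (a n : ℕ) (z : XTerm 𝒜 a (n + 2)) :
    XDiff 𝒜 x a n (XDiff 𝒜 x a (n + 1) z) = 0 := by
  obtain ⟨w, rfl⟩ := truncMap_surjective 𝒜 a (n + 2) z
  rw [XDiff_truncMap, XDiff_truncMap, FDiff_FDiff, map_zero]

theorem XAug_XDiff (hA : IsStandardGraded 𝒜) (a : ℕ) (z : XTerm 𝒜 a 1) :
    XAug 𝒜 a (XDiff 𝒜 x a 0 z) = 0 := by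
  obtain ⟨w, rfl⟩ := truncMap_surjective 𝒜 a 1 z
  rw [XDiff_truncMap, XAug_truncMap 𝒜 hA, FAug_FDiff, Submodule.Quotient.mk_zero]

theorem proj_multMap_eq_zero {i j : ℕ} (h : j < i) (t : BiTerm 𝒜 0 i) :
    GradedAlgebra.proj 𝒜 j (multMap 𝒜 (𝒜 i).subtype t) = 0 := by
  induction t using TensorProduct.induction_on with
  | zero => rw [map_zero, map_zero]
  | add t s ht hs => rw [map_add, map_add, ht, hs, add_zero]
  | tmul y s =>
    induction s using TensorProduct.induction_on with
    | zero => rw [TensorProduct.tmul_zero, map_zero, map_zero]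
    | add t s ht hs => rw [TensorProduct.tmul_add, map_add, map_add, ht, hs, add_zero]
    | tmul c b =>
      rw [multMap_tmul, map_smul]
      have : GradedAlgebra.proj 𝒜 j (y * (𝒜 i).subtype b) ∈ (⊥ : Submodule k A) := by
        refine proj_mul_mem _ _ _ _ fun p q hpq => ?_
        rw [Submodule.subtype_apply, proj_of_mem b.2, if_neg (by omega), mul_zero]
        exact zero_mem _
      rw [(Submodule.mem_bot k).mp this, smul_zero]

/-- The products over all columns sum to an element of $\mathfrak m^a$, which has no component of
degree $j<a$. Columns before $j$ are zero and later ones contribute only in degrees above $j$, so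
the degree $j$ part of the product of `z j` vanishes and exactness of column $j$ applies. -/
theorem mem_range_dVert_of_XAug (hA : IsStandardGraded 𝒜) (hK : IsKoszul 𝒜) (a : ℕ) (j : Fin a)
    (z : XTerm 𝒜 a 0) (hz : ∀ i < j, z i = 0) (h : XAug 𝒜 a z = 0) :
    z j ∈ Set.range (dVert 𝒜 x 0 (𝒜 j)) := by
  apply mem_range_dVert_zero 𝒜 x hA hK
  have hsum : XAug 𝒜 a z =
      (maxIdeal 𝒜 ^ a).mkQ (∑ i : Fin a, multMap 𝒜 (𝒜 i).subtype (z i)) := by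
    conv_lhs => rw [← sum_lof (R := A) z]
    rw [map_sum, map_sum]
    exact Finset.sum_congr rfl fun i _ => XAug_lof 𝒜 a i (z i)
  rw [hsum, Submodule.mkQ_apply, Submodule.Quotient.mk_eq_zero] at h
  have h' := proj_eq_zero_of_mem_pow h j.2
  rw [map_sum, Finset.sum_eq_single_of_mem j (Finset.mem_univ _)] at h'
  · exact h'
  · intro i _ hij
    rcases lt_or_gt_of_ne hij with hlt | hgt
    · rw [hz i hlt, map_zero, map_zero]
    · exact proj_multMap_eq_zero 𝒜 hgt (z i)

/-- The leading column of a cycle is a cycle for $\partial'$, hence a boundary for $\partial'$. -/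
theorem exact_XDiff (hA : IsStandardGraded 𝒜) (hK : IsKoszul 𝒜) (a n : ℕ) :
    Function.Exact (XDiff 𝒜 x a (n + 1)) (XDiff 𝒜 x a n) := by
  intro z
  constructor
  · refine mem_range_of_triangular (XDiff 𝒜 x a (n + 1)) (XDiff 𝒜 x a n)
      (fun j => dVert 𝒜 x (n + 1) (𝒜 j)) (XDiff_lof_apply_of_lt 𝒜 x a (n + 1))
      (XDiff_lof_apply_self 𝒜 x a (n + 1)) (XDiff_XDiff 𝒜 x a n) ?_ z
    intro j z hz h
    refine (dVert_exact 𝒜 x hA hK n (𝒜 j) _).mp ?_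
    have := apply_of_triangular (XDiff 𝒜 x a n) (fun j => dVert 𝒜 x n (𝒜 j))
      (XDiff_lof_apply_of_lt 𝒜 x a n) (XDiff_lof_apply_self 𝒜 x a n) z j hz
    rw [← this, h, DirectSum.zero_apply]
  · rintro ⟨w, rfl⟩
    exact XDiff_XDiff 𝒜 x a n w

theorem exact_XAug (hA : IsStandardGraded 𝒜) (hK : IsKoszul 𝒜) (a : ℕ) :
    Function.Exact (XDiff 𝒜 x a 0) (XAug 𝒜 a) := by
  intro z
  constructor
  · exact mem_range_of_triangular (XDiff 𝒜 x a 0) (XAug 𝒜 a) (fun j => dVert 𝒜 x 0 (𝒜 j))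
      (XDiff_lof_apply_of_lt 𝒜 x a 0) (XDiff_lof_apply_self 𝒜 x a 0) (XAug_XDiff 𝒜 x hA a)
      (mem_range_dVert_of_XAug 𝒜 x hA hK a) z
  · rintro ⟨w, rfl⟩
    exact XAug_XDiff 𝒜 x hA a w

theorem XAug_surjective {a : ℕ} (ha : 1 ≤ a) : Function.Surjective (XAug 𝒜 a) := by
  intro q
  obtain ⟨y, rfl⟩ := Submodule.Quotient.mk_surjective _ q
  obtain ⟨c, hc⟩ := exists_codual_zero 𝒜 1
  refine ⟨DirectSum.lof A (Fin a) (fun j => BiTerm 𝒜 0 j) ⟨0, ha⟩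
    (y ⊗ₜ (c ⊗ₜ ⟨1, SetLike.GradedOne.one_mem⟩)), ?_⟩
  rw [XAug_lof, multMap_tmul, hc, one_smul, Submodule.subtype_apply, mul_one]

omit [GradedAlgebra 𝒜] in
theorem lof_mem_XGrading {a n : ℕ} (j : Fin a) {p : ℕ} {y : A} (hy : y ∈ 𝒜 p) (c : CoDual 𝒜 n)
    (b : 𝒜 j) {N : ℕ} (hN : p + n + j = N) :
    DirectSum.lof A (Fin a) (fun j => BiTerm 𝒜 n j) j (y ⊗ₜ[k] (c ⊗ₜ[k] b)) ∈
      XGrading 𝒜 a n N :=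
  Submodule.subset_span ⟨j, p, ⟨y, hy⟩, c, b, hN, rfl⟩

theorem lof_dVert_mem {a n : ℕ} (j : Fin a) {p : ℕ} {y : A} (hy : y ∈ 𝒜 p)
    (c : CoDual 𝒜 (n + 1)) (b : 𝒜 j) {N : ℕ} (hN : p + 1 + n + j = N) :
    DirectSum.lof A (Fin a) (fun j => BiTerm 𝒜 n j) j
      (dVert 𝒜 x n (𝒜 j) (y ⊗ₜ[k] (c ⊗ₜ[k] b))) ∈ XGrading 𝒜 a n N := by
  rw [dVert_tmul, map_sum]
  exact Submodule.sum_mem _ fun l _ =>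
    lof_mem_XGrading 𝒜 j (SetLike.GradedMul.mul_mem hy (x l).2) _ b hN

theorem lof_dHor_mem {a n i : ℕ} (j : Fin a) (μ : 𝒜 1 → 𝒜 i →ₗ[k] 𝒜 j) {p : ℕ} {y : A}
    (hy : y ∈ 𝒜 p) (c : CoDual 𝒜 (n + 1)) (b : 𝒜 i) {N : ℕ} (hN : p + n + j = N) :
    DirectSum.lof A (Fin a) (fun j => BiTerm 𝒜 n j) j
      (dHor 𝒜 x n μ (y ⊗ₜ[k] (c ⊗ₜ[k] b))) ∈ XGrading 𝒜 a n N := by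
  rw [dHor_tmul, map_sum]
  exact Submodule.sum_mem _ fun l _ => lof_mem_XGrading 𝒜 j hy _ (μ (x l) b) hN

theorem XDiff_lof_mem {a n : ℕ} (j : Fin a) {p : ℕ} {y : A} (hy : y ∈ 𝒜 p)
    (c : CoDual 𝒜 (n + 1)) (b : 𝒜 j) {N : ℕ} (hN : p + (n + 1) + j = N) :
    XDiff 𝒜 x a n (DirectSum.lof A (Fin a) (fun j => BiTerm 𝒜 (n + 1) j) j
      (y ⊗ₜ[k] (c ⊗ₜ[k] b))) ∈ XGrading 𝒜 a n N := by
  rw [XDiff_lof']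
  refine add_mem (lof_dVert_mem 𝒜 x j hy c b (by omega)) ?_
  split_ifs with h
  · have hy' : (-1 : A) ^ (n + 1) • y ∈ 𝒜 p := by
      rcases neg_one_pow_eq_or A (n + 1) with h | h
      · rwa [h, one_smul]
      · rw [h, neg_one_smul]
        exact neg_mem hy
    have hN' : p + n + (j + 1) = N := by omega
    rw [TensorProduct.smul_tmul']
    exact lof_dHor_mem 𝒜 x ⟨j + 1, h⟩ (mulComponent 𝒜 j) hy' c b hN'
  · exact zero_mem _

theorem XDiff_mem (a n N : ℕ) (z : XTerm 𝒜 a (n + 1)) (hz : z ∈ XGrading 𝒜 a (n + 1) N) :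
    XDiff 𝒜 x a n z ∈ XGrading 𝒜 a n N := by
  induction hz using Submodule.span_induction with
  | mem z hz =>
    obtain ⟨j, p, y, c, b, hN, rfl⟩ := hz
    exact XDiff_lof_mem 𝒜 x j y.2 c b hN
  | zero => rw [map_zero]; exact zero_mem _
  | add z w _ _ hz hw => rw [map_add]; exact add_mem hz hw
  | smul r z _ hz =>
    rw [LinearMap.map_smul_of_tower]
    exact Submodule.smul_mem _ r hz

theorem XAug_mem (a N : ℕ) (z : XTerm 𝒜 a 0) (hz : z ∈ XGrading 𝒜 a 0 N) :
    XAug 𝒜 a z ∈ quotGrading 𝒜 (maxIdeal 𝒜 ^ a) N := by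
  induction hz using Submodule.span_induction with
  | mem z hz =>
    obtain ⟨j, p, y, c, b, hN, rfl⟩ := hz
    rw [XAug_lof, multMap_tmul]
    refine ⟨_, Submodule.smul_mem _ _ ?_, rfl⟩
    have := SetLike.GradedMul.mul_mem y.2 b.2
    rwa [show p + (j : ℕ) = N by omega] at this
  | zero => rw [map_zero]; exact zero_mem _
  | add z w _ _ hz hw => rw [map_add]; exact add_mem hz hw
  | smul r z _ hz =>
    rw [LinearMap.map_smul_of_tower]
    exact Submodule.smul_mem _ r hz

theorem isGradedFree_XGrading (hA : IsStandardGraded 𝒜) (a n : ℕ) :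
    IsGradedFree (M := XTerm 𝒜 a n) 𝒜 (XGrading 𝒜 a n) := by
  have := hA.nontrivial
  -- `XGrading` is by definition `sumGrading` for $C=(A^!)^*_n$.
  exact isGradedFree_sumGrading 𝒜 n

theorem isGradedFreeResolution_XTerm (hA : IsStandardGraded 𝒜) (hK : IsKoszul 𝒜) {a : ℕ}
    (ha : 1 ≤ a) :
    IsGradedFreeResolution 𝒜 (P := XTerm 𝒜 a) (XGrading 𝒜 a) (XDiff 𝒜 x a)
      (quotGrading 𝒜 (maxIdeal 𝒜 ^ a)) (XAug 𝒜 a) :=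
  ⟨isGradedFree_XGrading 𝒜 hA a, XDiff_mem 𝒜 x a, XAug_mem 𝒜 a, exact_XDiff 𝒜 x hA hK a,
    exact_XAug 𝒜 x hA hK a, XAug_surjective 𝒜 ha⟩

end Resolution

end KoszulTrunc

end

theorem corollary4p4 {k : Type*} {A : Type*} [Field k] [Ring A] [Algebra k A]
    (𝒜 : ℕ → Submodule k A) [GradedAlgebra 𝒜]
    (hA : KoszulTrunc.IsStandardGraded 𝒜) (hK : KoszulTrunc.IsKoszul 𝒜)
    {ι : Type*} [Fintype ι] (x : Module.Basis ι k (𝒜 1)) (a : ℕ) (ha : 1 ≤ a) :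
    KoszulTrunc.IsGradedFreeResolution 𝒜 (P := KoszulTrunc.XTerm 𝒜 a)
        (KoszulTrunc.XGrading 𝒜 a) (KoszulTrunc.XDiff 𝒜 x a)
        (KoszulTrunc.quotGrading 𝒜 (KoszulTrunc.maxIdeal 𝒜 ^ a)) (KoszulTrunc.XAug 𝒜 a) ∧
      ∃ e : ∀ n, (KoszulTrunc.FTerm 𝒜 n ⧸
          KoszulTrunc.FMulIdeal 𝒜 n (KoszulTrunc.maxIdeal 𝒜 ^ a)) ≃ₗ[A] KoszulTrunc.XTerm 𝒜 a n,
        (∀ (n : ℕ) (j : Fin a) (y : A) (c : KoszulTrunc.CoDual 𝒜 n) (b : 𝒜 j),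
          e n (Submodule.Quotient.mk (y ⊗ₜ[k] (c ⊗ₜ[k] (b : A)))) =
            DirectSum.lof A (Fin a) (fun j => KoszulTrunc.BiTerm 𝒜 n j) j
              (y ⊗ₜ[k] (c ⊗ₜ[k] b))) ∧
        (∀ (n : ℕ) (z : KoszulTrunc.FTerm 𝒜 (n + 1)),
          KoszulTrunc.XDiff 𝒜 x a n (e (n + 1) (Submodule.Quotient.mk z)) =
            e n (Submodule.Quotient.mk (KoszulTrunc.FDiff 𝒜 x n z))) ∧
        ∀ z : KoszulTrunc.FTerm 𝒜 0,
          KoszulTrunc.XAug 𝒜 a (e 0 (Submodule.Quotient.mk z)) =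
            Submodule.Quotient.mk (KoszulTrunc.FAug 𝒜 z) := by
  refine ⟨KoszulTrunc.isGradedFreeResolution_XTerm 𝒜 x hA hK ha, ?_⟩
  choose e he using KoszulTrunc.exists_truncEquiv 𝒜 hA a
  refine ⟨e, fun n j y c b => ?_, fun n z => ?_, fun z => ?_⟩
  · rw [he, KoszulTrunc.truncMap_coe, dif_pos j.2]
  · rw [he, he, KoszulTrunc.XDiff_truncMap]
  · rw [he, KoszulTrunc.XAug_truncMap 𝒜 hA]
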